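/- Let $\sigma\subseteq\mathbb R\setminus\{0\}$ be a (necessarily discrete) set with $\sum_{\lambda\in\sigma}\frac1{|\lambda|}<\infty$ and put $$W(z)=\prod_{\lambda\in\sigma}\Bigl(1-\frac z\lambda\Bigr),\qquad z\in\mathbb C.$$ For coupling constants $\eta_\lambda\in\mathbb R\cup\{\infty\}$, $\lambda\in\sigma$ (one unsigned point $\infty$), a \emph{solution of the coupling problem} with data $\{\eta_\lambda\}_{\lambda\in\sigma}$ is a pair $(\Phi_-,\Phi_+)$ of entire functions of exponential type zero (that is, for every $\varepsilon>0$ there is a $C$ with $|\Phi_\pm(z)|\le Ce^{\varepsilon|z|}$ for all $z\in\mathbb C$) such that (C) $\Phi_+(\lambda)=\eta_\lambda\Phi_-(\lambda)$ for all $\lambda\in\sigma$, to be read as $\Phi_-(\lambda)=0$ if $\eta_\lambda=\infty$; (G) $\operatorname{Im}\left(\dfrac{z\,\Phi_-(z)\Phi_+(z)}{W(z)}\right)\ge0$ whenever $\operatorname{Im}(z)>0$; (N) $\Phi_-(0)=\Phi_+(0)=1$. Let $\Delta$ be a first-countable topological space, $\delta_\infty\in\Delta$ and $D\subseteq\Delta$;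 throughout, $\delta\to\delta_\infty$ means that $\delta$ tends to $\delta_\infty$ within $D$ (so $D=\Delta$ gives the full and $D=\Delta\setminus\{\delta_\infty\}$ the punctured limit). For every $\delta\in\Delta$ let coupling constants $\eta_\lambda(\delta)\in\mathbb R\cup\{\infty\}$, $\lambda\in\sigma$, be given. Suppose that $\sigma$ is the disjoint union $\sigma_-\cup\{\lambda_0\}\cup\sigma_+$ and that $$-\ln|\eta_\lambda(\delta)|\to\pm\infty\quad\text{as }\delta\to\delta_\infty,\qquad\text{for each }\lambda\in\sigma_\pm,$$ where $-\ln|0|=+\infty$ and $-\ln|\infty|=-\infty$. Define $$\hat\eta_{\lambda_0}(\delta)=\eta_{\lambda_0}(\delta)\prod_{\lambda\in\sigma_-}\Bigl(1-\frac{\lambda_0}{\lambda}\Bigr)\prod_{\lambda\in\sigma_+}\Bigl(1-\frac{\lambda_0}{\lambda}\Bigr)^{-1}\in\mathbb R\cup\{\infty\}.$$ If for every $\delta\in D$ the pair $(\Phi_-(\,\cdot\,,\delta),\Phi_+(\,\cdot\,,\delta))$ is a solution of the coupling problem with data $\{\eta_\lambda(\delta)\}_{\lambda\in\sigma}$, then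 $$\frac{\Phi_-(z,\delta)\Phi_+(z,\delta)}{W(z)}=1+\frac{z}{\lambda_0-z}\,\min\bigl(\hat\eta_{\lambda_0}(\delta)^{-1},\hat\eta_{\lambda_0}(\delta)\bigr)+o(1)$$ as $\delta\to\delta_\infty$, locally uniformly for $z\in\mathbb C\setminus\sigma$. Here $0^{-1}=\infty$, $\infty^{-1}=0$, and in the minimum $\infty$ counts as larger than every real number (so that the minimum is always a real number, equal to $0$ if $\hat\eta_{\lambda_0}(\delta)\in\{0,\infty\}$). -/

import Mathlib

open Filter Topology

/-- Coupling constants: elements of `ℝ ∪ {∞}`.  Here `∞ = ⊤` is the single (unsigned) point at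
infinity; the order (used only for the minimum) is the one in which `∞` is the largest element. -/
abbrev CouplingConst : Type := WithTop ℝ

namespace CouplingConst

/-- `-ln |η|` as an extended real number, with `-ln |0| = +∞` and `-ln |∞| = -∞`. -/
noncomputable def negLogAbs : CouplingConst → EReal
  | none => ⊥
  | some x => if x = 0 then ⊤ else ((-Real.log |x| : ℝ) : EReal)

/-- The product of `η ∈ ℝ ∪ {∞}` with a (nonzero) real number `c`; in particular `∞ * c = ∞`. -/
noncomputable def mulReal (η : CouplingConst) (c : ℝ) : CouplingConst :=
  WithTop.map (fun x => x * c) η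

/-- The inverse on `ℝ ∪ {∞}`, with `0⁻¹ = ∞` and `∞⁻¹ = 0`. -/
noncomputable def recip : CouplingConst → CouplingConst
  | none => ((0 : ℝ) : WithTop ℝ)
  | some x => if x = 0 then ⊤ else ((x⁻¹ : ℝ) : WithTop ℝ)

/-- `min (η⁻¹, η)`, taken in `ℝ ∪ {∞}`.  It is never `∞` (see `coe_minRecip`), so it is recorded as
a real number. -/
noncomputable def minRecip (η : CouplingConst) : ℝ :=
  (min (recip η) η).untopD 0

theorem negLogAbs_top : negLogAbs ⊤ = ⊥ := rfl

theorem negLogAbs_zero : negLogAbs ((0 : ℝ) : WithTop ℝ) = ⊤ := if_pos rfl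

theorem negLogAbs_coe {x : ℝ} (hx : x ≠ 0) :
    negLogAbs (x : WithTop ℝ) = ((-Real.log |x| : ℝ) : EReal) := if_neg hx

theorem recip_top : recip ⊤ = ((0 : ℝ) : WithTop ℝ) := rfl

theorem recip_zero : recip ((0 : ℝ) : WithTop ℝ) = ⊤ := if_pos rfl

theorem recip_coe {x : ℝ} (hx : x ≠ 0) :
    recip (x : WithTop ℝ) = ((x⁻¹ : ℝ) : WithTop ℝ) := if_neg hx

theorem coe_minRecip (η : CouplingConst) : (minRecip η : WithTop ℝ) = min (recip η) η := by
  unfold minRecip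
  have h : min (recip η) η ≠ ⊤ := by
    intro h
    rw [min_eq_top] at h
    obtain ⟨h1, h2⟩ := h
    subst h2
    rw [recip_top] at h1
    exact WithTop.coe_ne_top h1
  obtain ⟨x, hx⟩ := WithTop.ne_top_iff_exists.mp h
  rw [← hx, WithTop.untopD_coe]

end CouplingConst

/-- The (canonical) product `W(z) = ∏_{λ ∈ σ} (1 - z / λ)`. -/
noncomputable def couplingW (σ : Set ℝ) (z : ℂ) : ℂ :=
  ∏' s : σ, (1 - z / ((s : ℝ) : ℂ))

/-- The product defining `couplingW` converges as soon as `∑ 1 / |λ|` is finite. -/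
theorem multipliable_couplingW {σ : Set ℝ} (hσ : Summable fun s : σ => 1 / |(s : ℝ)|) (z : ℂ) :
    Multipliable fun s : σ => (1 - z / ((s : ℝ) : ℂ)) := by
  have h : Summable fun s : σ => ‖-(z / ((s : ℝ) : ℂ))‖ := by
    refine (hσ.mul_left ‖z‖).congr fun s => ?_
    rw [norm_neg, norm_div, Complex.norm_real, Real.norm_eq_abs, mul_one_div]
  simpa [sub_eq_add_neg] using multipliable_one_add_of_summable h

/-- `f` is an entire function of exponential type zero. -/
def IsEntireTypeZero (f : ℂ → ℂ) : Prop :=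
  Differentiable ℂ f ∧ ∀ ε : ℝ, 0 < ε → ∃ C : ℝ, ∀ z : ℂ, ‖f z‖ ≤ C * Real.exp (ε * ‖z‖)

/-- `(Φm, Φp)` is a solution of the coupling problem on `σ` with data `η`. -/
structure IsCouplingSolution (σ : Set ℝ) (η : σ → CouplingConst) (Φm Φp : ℂ → ℂ) : Prop where
  entire_m : IsEntireTypeZero Φm
  entire_p : IsEntireTypeZero Φp
  /-- Coupling condition at the points with a finite coupling constant. -/
  coupling : ∀ (s : σ) (x : ℝ), η s = (x : WithTop ℝ) →
    Φp ((s : ℝ) : ℂ) = (x : ℂ) * Φm ((s : ℝ) : ℂ)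
  /-- Coupling condition at the points with coupling constant `∞`. -/
  coupling_top : ∀ s : σ, η s = ⊤ → Φm ((s : ℝ) : ℂ) = 0
  /-- Growth and positivity condition. -/
  growth : ∀ z : ℂ, 0 < z.im → 0 ≤ (z * Φm z * Φp z / couplingW σ z).im
  /-- Normalization condition. -/
  norm_m : Φm 0 = 1
  norm_p : Φp 0 = 1

/-- The conjugated coupling constant
`η̂ = η * ∏_{λ ∈ σ₋} (1 - λ₀ / λ) * ∏_{λ ∈ σ₊} (1 - λ₀ / λ)⁻¹`. -/
noncomputable def conjugatedConst {σ : Set ℝ} (l₀ : σ) (σm σp : Set σ) (η : CouplingConst) :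
    CouplingConst :=
  η.mulReal ((∏' s : σm, (1 - (l₀ : ℝ) / ((s : σ) : ℝ))) *
    ∏' s : σp, (1 - (l₀ : ℝ) / ((s : σ) : ℝ))⁻¹)

/-! Compactness together with a rigidity statement for the limits. Along an ultrafilter finer than
the given limit, the solutions converge locally uniformly to entire functions `fm`, `fp`. Since the
other factor stays bounded, `η → ∞` on `σm` forces `fm` to vanish there, and `η → 0` on `σp` forces
`fp` to vanish there. Hence `fm = W₋ gm` and `fp = W₊ gp`, where `W₋`, `W₊` are the products over
`σm`, `σp`.

For a product `P = Φ₋Φ₊`, the function `zP/W` is Herglotz with derivative `1` at `0`, and Julia's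
inequality (`IsPositiveNumerator.norm_mul_im_le_of_pos`) gives `|P(z)| |Im z| ≤ |W(z)| |z|`. In the
limit, `|gm gp| |Im z| ≤ |1 - z/λ₀| |z|`, so `gm gp` is affine
(`exists_eq_add_mul_of_norm_mul_abs_im_le`). With `γ = gm(λ₀) gp(λ₀)` the limiting quotient is
therefore `1 + γ z/(λ₀ - z)`, and positivity forces `γ ≤ 1`.

It remains to recognize `γ`. Two normalized entire functions of zero mean type with affine product
cannot both have zeros, as these would make a double zero; a zero-free one is `1`
(`eq_one_or_eq_one_of_mul_eq_linear`). If `gm = 1`, the identity `η̂ (Φ₋(λ₀)/W₋(λ₀))² =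
P(λ₀)/(W₋(λ₀) W₊(λ₀))` shows `η̂ → γ`; if `gp = 1`, the same argument applies to `η̂⁻¹`. As `γ ≤ 1`,
the minimum tends to `γ` in both cases.

Compactness needs a majorant depending on `σ` alone (`IsPositiveNumerator.norm_le_of_mul`). By
Jensen, the integrated zero count of either factor is at most the circle average of `log |P|`, which
Julia's inequality bounds by that of `log |W|` plus `log 2`. Integrating over radii bounds the
canonical products of the factor, and `HasZeroMeanType.exists_rootPoly_mul` says that these
approximate the factor itself. -/

/-! ### Circle averages of `log |f|` and Jensen's inequality. -/

section CircleAverages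

open Metric Complex

theorem eventually_codiscreteWithin_ne_zero {f : ℂ → ℂ} (hf : Differentiable ℂ f) {x : ℂ}
    (hx : f x ≠ 0) (s : Set ℂ) : ∀ᶠ z in codiscreteWithin s, f z ≠ 0 := by
  have h1 : f ⁻¹' {0}ᶜ ∈ codiscrete ℂ :=
    AnalyticOnNhd.preimage_zero_mem_codiscrete (x := x) (fun z _ => hf.analyticAt z) hx
  exact Filter.codiscreteWithin_mono (Set.subset_univ s) h1

theorem circleIntegrable_log_norm {f : ℂ → ℂ} (hf : Differentiable ℂ f) (c : ℂ) (R : ℝ) :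
    CircleIntegrable (fun z => Real.log ‖f z‖) c R :=
  MeromorphicOn.circleIntegrable_log_norm fun z _ => (hf.analyticAt z).meromorphicAt

theorem circleIntegrable_posLog_norm {f : ℂ → ℂ} (hf : Differentiable ℂ f) (c : ℂ) (R : ℝ) :
    CircleIntegrable (fun z => Real.posLog ‖f z‖) c R :=
  MeromorphicOn.circleIntegrable_posLog_norm fun z _ => (hf.analyticAt z).meromorphicAt

/-- Since `Real.log 0 = 0`, inequalities between logarithms of moduli can fail at zeros; this
version tolerates a discrete exceptional set. -/
theorem circleAverage_mono_codiscreteWithin {u v : ℂ → ℝ} {c : ℂ} {R : ℝ}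
    (hu : CircleIntegrable u c R) (hv : CircleIntegrable v c R) (hR : R ≠ 0)
    (h : ∀ᶠ z in codiscreteWithin (sphere c |R|), u z ≤ v z) :
    Real.circleAverage u c R ≤ Real.circleAverage v c R := by
  have h1 : u =ᶠ[codiscreteWithin (sphere c |R|)] fun z => min (u z) (v z) := by
    filter_upwards [h] with z hz using (min_eq_left hz).symm
  rw [Real.circleAverage_congr_codiscreteWithin h1 hR]
  exact Real.circleAverage_mono (hu.congr_codiscreteWithin h1) hv fun z _ => min_le_right _ _

theorem circleAverage_log_norm_mul {f g : ℂ → ℂ} (hf : Differentiable ℂ f)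
    (hg : Differentiable ℂ g) {x y : ℂ} (hx : f x ≠ 0) (hy : g y ≠ 0) {R : ℝ} (hR : R ≠ 0)
    (c : ℂ) :
    Real.circleAverage (fun z => Real.log ‖f z * g z‖) c R =
      Real.circleAverage (fun z => Real.log ‖f z‖) c R +
        Real.circleAverage (fun z => Real.log ‖g z‖) c R := by
  rw [← Real.circleAverage_fun_add (circleIntegrable_log_norm hf c R)
    (circleIntegrable_log_norm hg c R)]
  refine Real.circleAverage_congr_codiscreteWithin ?_ hR
  filter_upwards [eventually_codiscreteWithin_ne_zero hf hx _,
    eventually_codiscreteWithin_ne_zero hg hy _] with z h1 h2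
  rw [norm_mul, Real.log_mul (norm_ne_zero_iff.2 h1) (norm_ne_zero_iff.2 h2)]

theorem circleAverage_log_norm_le {f g : ℂ → ℂ} (hf : Differentiable ℂ f)
    (hg : Differentiable ℂ g) {x : ℂ} (hx : f x ≠ 0) {c : ℂ} {R : ℝ} (hR : R ≠ 0)
    (h : ∀ z ∈ sphere c |R|, ‖f z‖ ≤ ‖g z‖) :
    Real.circleAverage (fun z => Real.log ‖f z‖) c R ≤
      Real.circleAverage (fun z => Real.log ‖g z‖) c R := by
  refine circleAverage_mono_codiscreteWithin (circleIntegrable_log_norm hf c R)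
    (circleIntegrable_log_norm hg c R) hR ?_
  filter_upwards [eventually_codiscreteWithin_ne_zero hf hx _,
    self_mem_codiscreteWithin (sphere c |R|)] with z h1 h2
  exact Real.log_le_log (norm_pos_iff.2 h1) (h z h2)

/-- Jensen's inequality. -/
theorem circleAverage_log_norm_nonneg {f : ℂ → ℂ} (hf : Differentiable ℂ f) (h0 : f 0 = 1)
    {R : ℝ} (hR : 0 < R) : 0 ≤ Real.circleAverage (fun z => Real.log ‖f z‖) 0 R := by
  have hA : AnalyticOnNhd ℂ f (closedBall 0 |R|) := fun z _ => hf.analyticAt z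
  rw [AnalyticOnNhd.circleAverage_log_norm hR.ne' hA (by simp [h0])]
  simp only [h0, norm_one, Real.log_one, add_zero]
  refine finsum_nonneg fun u => ?_
  by_cases hu : u ∈ closedBall (0 : ℂ) |R|
  · refine mul_nonneg (mod_cast MeromorphicOn.AnalyticOnNhd.divisor_nonneg hA u) ?_
    rw [abs_of_pos hR, mem_closedBall_zero_iff] at hu
    rcases eq_or_ne u 0 with rfl | h
    · simp
    · apply Real.log_nonneg
      rw [zero_sub, norm_neg, ← div_eq_mul_inv, one_le_div (norm_pos_iff.2 h)]
      exact hu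
  · simp [Function.locallyFinsuppWithin.apply_eq_zero_of_notMem _ hu]

theorem circleAverage_log_norm_le_posLog {f : ℂ → ℂ} (hf : Differentiable ℂ f) (c : ℂ) (R : ℝ) :
    Real.circleAverage (fun z => Real.log ‖f z‖) c R ≤
      Real.circleAverage (fun z => Real.posLog ‖f z‖) c R :=
  Real.circleAverage_mono (circleIntegrable_log_norm hf c R)
    (circleIntegrable_posLog_norm hf c R) fun z _ => by simp [Real.posLog]

theorem circleAverage_log_norm_one_sub_div {μ : ℂ} (hμ : μ ≠ 0) {R : ℝ} (hR : 0 < R) :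
    Real.circleAverage (fun z => Real.log ‖1 - z / μ‖) 0 R = Real.posLog (R / ‖μ‖) := by
  have h0 : (fun z : ℂ => 1 - z / μ) = fun z => (-μ⁻¹) * (z - μ) := by
    funext z; field_simp; ring
  have h1 := circleAverage_log_norm_mul (f := fun _ => -μ⁻¹) (g := fun z => z - μ)
    (by fun_prop) (by fun_prop) (x := 0) (y := 0) (by simpa using hμ) (by simpa using hμ)
    hR.ne' 0
  have h2 : (fun z : ℂ => Real.log ‖1 - z / μ‖) = fun z => Real.log ‖(-μ⁻¹) * (z - μ)‖ := by
    funext z; rw [← congrFun h0 z]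
  rw [h2, h1, Real.circleAverage_const,
    circleAverage_log_norm_sub_const_eq_log_radius_add_posLog hR.ne', zero_sub, norm_neg,
    norm_neg, norm_inv, Real.log_inv]
  have h3 := Real.posLog_sub_posLog_inv (x := R / ‖μ‖)
  rw [Real.log_div hR.ne' (norm_ne_zero_iff.2 hμ), inv_div] at h3
  rw [inv_mul_eq_div]
  linarith

end CircleAverages

/-! ### Dividing out the zeros in a disc. -/

section Factorization

open Metric Complex

/-- The polynomial `∏ (1 - z / μ)` with prescribed nonzero roots. -/
noncomputable def rootPoly (M : Multiset ℂ) (z : ℂ) : ℂ := (M.map fun μ => 1 - z / μ).prod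

theorem rootPoly_cons (μ : ℂ) (M : Multiset ℂ) (z : ℂ) :
    rootPoly (μ ::ₘ M) z = (1 - z / μ) * rootPoly M z := by simp [rootPoly]

theorem rootPoly_empty (z : ℂ) : rootPoly 0 z = 1 := by simp [rootPoly]

theorem rootPoly_zero (M : Multiset ℂ) : rootPoly M 0 = 1 := by
  simp [rootPoly]

theorem differentiable_rootPoly (M : Multiset ℂ) : Differentiable ℂ (rootPoly M) := by
  induction M using Multiset.induction with
  | empty => simp only [funext rootPoly_empty]; fun_prop
  | cons μ M ih => simp only [funext (rootPoly_cons μ M)]; fun_prop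

theorem circleAverage_log_norm_rootPoly {M : Multiset ℂ} (hM : ∀ μ ∈ M, μ ≠ 0) {R : ℝ}
    (hR : 0 < R) :
    Real.circleAverage (fun z => Real.log ‖rootPoly M z‖) 0 R =
      (M.map fun μ => Real.posLog (R / ‖μ‖)).sum := by
  induction M using Multiset.induction with
  | empty => simp [rootPoly_empty, Real.circleAverage_const]
  | cons μ M ih =>
    simp only [rootPoly_cons, Multiset.map_cons, Multiset.sum_cons]
    rw [circleAverage_log_norm_mul (f := fun z => 1 - z / μ) (by fun_prop)
      (differentiable_rootPoly M) (x := 0) (y := 0) (by simp) (by simp [rootPoly_zero]) hR.ne',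
      circleAverage_log_norm_one_sub_div (hM μ (by simp)) hR,
      ih fun ν hν => hM ν (by simp [hν])]

theorem posLog_norm_rootPoly_le (M : Multiset ℂ) (z : ℂ) :
    Real.posLog ‖rootPoly M z‖ ≤ (M.map fun μ => Real.log (1 + ‖z‖ / ‖μ‖)).sum := by
  induction M using Multiset.induction with
  | empty => simp [rootPoly_empty]
  | cons μ M ih =>
    simp only [rootPoly_cons, Multiset.map_cons, Multiset.sum_cons, norm_mul]
    refine Real.posLog_mul.trans (add_le_add ?_ ih)
    have h1 : (0 : ℝ) ≤ ‖z‖ / ‖μ‖ := by positivity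
    have h2 : ‖1 - z / μ‖ ≤ 1 + ‖z‖ / ‖μ‖ := by
      simpa using norm_sub_le (1 : ℂ) (z / μ)
    refine (Real.posLog_le_posLog (norm_nonneg _) h2).trans (le_of_eq ?_)
    exact Real.posLog_eq_log (by rw [abs_of_nonneg] <;> linarith)

theorem exists_eq_one_sub_div_mul {k : ℂ → ℂ} (hk : Differentiable ℂ k) {a : ℂ} (ha : a ≠ 0)
    (h : k a = 0) : ∃ g : ℂ → ℂ, Differentiable ℂ g ∧ ∀ z, k z = (1 - z / a) * g z := by
  refine ⟨fun z => -a * dslope k a z, ?_, fun z => ?_⟩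
  · have h1 : DifferentiableOn ℂ (dslope k a) Set.univ :=
      (Complex.differentiableOn_dslope univ_mem).2 hk.differentiableOn
    exact (differentiableOn_univ.1 h1).const_mul _
  · have h1 := sub_smul_dslope k a z
    rw [h, sub_zero, smul_eq_mul] at h1
    rw [← h1]; field_simp; ring

/-- Jensen's inequality for the cofactor. The multiset may be any partial list of zeros, so no full
zero divisor is ever needed. -/
theorem sum_posLog_le_circleAverage {f k : ℂ → ℂ} {M : Multiset ℂ} (hM : ∀ μ ∈ M, μ ≠ 0)
    (hk : Differentiable ℂ k) (hk0 : k 0 = 1) (h : ∀ z, f z = rootPoly M z * k z) {R : ℝ}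
    (hR : 0 < R) :
    (M.map fun μ => Real.posLog (R / ‖μ‖)).sum ≤
      Real.circleAverage (fun z => Real.log ‖f z‖) 0 R := by
  simp only [h]
  rw [circleAverage_log_norm_mul (differentiable_rootPoly M) hk (x := 0) (y := 0)
    (by simp [rootPoly_zero]) (by simp [hk0]) hR.ne', circleAverage_log_norm_rootPoly hM hR]
  linarith [circleAverage_log_norm_nonneg hk hk0 hR]

/-- Each root of modulus at most `R` contributes at least `log 2` to Jensen's sum at radius `2 * R`.
-/
theorem card_mul_log_two_le {f k : ℂ → ℂ} {M : Multiset ℂ} {R : ℝ} (hR : 0 < R)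
    (hM : ∀ μ ∈ M, μ ≠ 0 ∧ ‖μ‖ ≤ R)
    (hk : Differentiable ℂ k) (hk0 : k 0 = 1) (h : ∀ z, f z = rootPoly M z * k z) :
    M.card * Real.log 2 ≤ Real.circleAverage (fun z => Real.log ‖f z‖) 0 (2 * R) := by
  refine le_trans ?_ (sum_posLog_le_circleAverage (fun μ hμ => (hM μ hμ).1) hk hk0 h
    (by positivity : 0 < 2 * R))
  have h1 : ∀ x ∈ M.map fun μ => Real.posLog (2 * R / ‖μ‖), Real.log 2 ≤ x := by
    intro x hx
    obtain ⟨μ, hμ, rfl⟩ := Multiset.mem_map.1 hx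
    have h2 : 0 < ‖μ‖ := norm_pos_iff.2 (hM μ hμ).1
    have h3 : 2 ≤ 2 * R / ‖μ‖ := by
      rw [le_div_iff₀ h2]; nlinarith [(hM μ hμ).2]
    exact (Real.log_le_log two_pos h3).trans (by simp [Real.posLog])
  simpa using Multiset.card_nsmul_le_sum h1

/-- `card_mul_log_two_le` bounds how many zeros can be split off. A factorization splitting off the
maximal number leaves a cofactor without zeros in the disc, for a remaining one could be divided out
as well. -/
theorem exists_rootPoly_mul {f : ℂ → ℂ} (hf : Differentiable ℂ f) (h0 : f 0 = 1) {R : ℝ}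
    (hR : 0 < R) :
    ∃ (M : Multiset ℂ) (k : ℂ → ℂ), (∀ μ ∈ M, μ ≠ 0 ∧ ‖μ‖ ≤ R) ∧ Differentiable ℂ k ∧ k 0 = 1 ∧
      (∀ z, f z = rootPoly M z * k z) ∧ ∀ z ∈ closedBall (0 : ℂ) R, k z ≠ 0 := by
  set p : ℕ → Prop := fun n => ∃ (M : Multiset ℂ) (k : ℂ → ℂ), M.card = n ∧
    (∀ μ ∈ M, μ ≠ 0 ∧ ‖μ‖ ≤ R) ∧ Differentiable ℂ k ∧ k 0 = 1 ∧ ∀ z, f z = rootPoly M z * k z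
  have hp0 : p 0 := ⟨0, f, by simp, by simp, hf, h0, fun z => by simp [rootPoly_empty]⟩
  obtain ⟨N, hN⟩ := exists_nat_ge (Real.circleAverage (fun z => Real.log ‖f z‖) 0 (2 * R) /
    Real.log 2)
  have hb : ∀ n, p n → n ≤ N := by
    rintro n ⟨M, k, rfl, hM, hk, hk0, hfk⟩
    have h1 := card_mul_log_two_le hR hM hk hk0 hfk
    rw [← le_div_iff₀ (Real.log_pos one_lt_two)] at h1
    exact_mod_cast h1.trans hN
  classical
  have hmax := Nat.findGreatest_spec (P := p) (Nat.zero_le N) hp0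
  obtain ⟨M, k, hc, hM, hk, hk0, hfk⟩ := hmax
  refine ⟨M, k, hM, hk, hk0, hfk, fun a ha hka => ?_⟩
  have ha0 : a ≠ 0 := by rintro rfl; simp [hk0] at hka
  obtain ⟨g, hg, hkg⟩ := exists_eq_one_sub_div_mul hk ha0 hka
  have h1 : p (M.card + 1) := by
    refine ⟨a ::ₘ M, g, by simp, ?_, hg, ?_, fun z => ?_⟩
    · intro μ hμ
      rcases Multiset.mem_cons.1 hμ with rfl | hμ
      · exact ⟨ha0, by simpa using ha⟩
      · exact hM μ hμ
    · have := hkg 0; rw [hk0] at this; simpa using this.symm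
    · rw [hfk, hkg, rootPoly_cons]; ring
  have h2 := Nat.le_findGreatest (hb _ h1) h1
  omega

/-- Off the zeros of `p`, `log⁺ |f/p| ≤ log⁺ |f| + log⁺ (1/|p|)`, and `log⁺ (1/x) = log⁺ x - log x`.
-/
theorem circleAverage_posLog_cofactor_le {f p k : ℂ → ℂ} (hf : Differentiable ℂ f)
    (hp : Differentiable ℂ p) (hk : Differentiable ℂ k) (hp0 : p 0 = 1)
    (h : ∀ z, f z = p z * k z) {R : ℝ} (hR : 0 < R) :
    Real.circleAverage (fun z => Real.posLog ‖k z‖) 0 R ≤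
      Real.circleAverage (fun z => Real.posLog ‖f z‖) 0 R +
        (Real.circleAverage (fun z => Real.posLog ‖p z‖) 0 R -
          Real.circleAverage (fun z => Real.log ‖p z‖) 0 R) := by
  have hint1 := circleIntegrable_posLog_norm hf 0 R
  have hint2 := circleIntegrable_posLog_norm hp 0 R
  have hint3 := circleIntegrable_log_norm hp 0 R
  have h6 := Real.circleAverage_fun_sub hint2 hint3
  rw [← h6, ← Real.circleAverage_fun_add (f₂ := fun z => Real.posLog ‖p z‖ - Real.log ‖p z‖)
    hint1 (hint2.sub hint3)]
  refine circleAverage_mono_codiscreteWithin (circleIntegrable_posLog_norm hk 0 R)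
    (hint1.add (hint2.sub hint3)) hR.ne' ?_
  filter_upwards [eventually_codiscreteWithin_ne_zero hp (x := 0) (by simp [hp0]) _] with z hz
  have h2 : ‖k z‖ = ‖f z‖ * ‖p z‖⁻¹ := by
    rw [h, norm_mul]; field_simp [norm_ne_zero_iff.2 hz]
  have h3 := Real.posLog_sub_posLog_inv (x := ‖p z‖)
  have h4 := Real.posLog_mul (x := ‖f z‖) (y := ‖p z‖⁻¹)
  rw [h2]; linarith

/-- On the circle, `log⁺` of the root polynomial exceeds its Jensen sum by at most `log 2` per root,
and the number of roots is controlled by the average at radius `2 * R`. -/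
theorem circleAverage_posLog_cofactor_rootPoly_le {f k : ℂ → ℂ} {M : Multiset ℂ} {R : ℝ}
    (hR : 0 < R) (hM : ∀ μ ∈ M, μ ≠ 0 ∧ ‖μ‖ ≤ R) (hf : Differentiable ℂ f)
    (hk : Differentiable ℂ k) (hk0 : k 0 = 1) (h : ∀ z, f z = rootPoly M z * k z) :
    Real.circleAverage (fun z => Real.posLog ‖k z‖) 0 R ≤
      Real.circleAverage (fun z => Real.posLog ‖f z‖) 0 R +
        Real.circleAverage (fun z => Real.posLog ‖f z‖) 0 (2 * R) := by
  have hp := differentiable_rootPoly M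
  have h1 := circleAverage_posLog_cofactor_le hf hp hk (rootPoly_zero M) h hR
  have h2 : Real.circleAverage (fun z => Real.posLog ‖rootPoly M z‖) 0 R ≤
      (M.map fun μ => Real.log (1 + R / ‖μ‖)).sum := by
    refine Real.circleAverage_mono_on_of_le_circle
      (circleIntegrable_posLog_norm hp 0 R) fun z hz => ?_
    have : ‖z‖ = R := by simpa [abs_of_pos hR] using hz
    simpa [this] using posLog_norm_rootPoly_le M z
  have h3 : (M.map fun μ => Real.log (1 + R / ‖μ‖)).sum ≤
      (M.map fun μ => Real.posLog (R / ‖μ‖)).sum + M.card * Real.log 2 := by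
    have : (M.card : ℝ) * Real.log 2 = (M.map fun _ => Real.log 2).sum := by simp
    rw [this, ← Multiset.sum_map_add]
    refine Multiset.sum_map_le_sum_map _ _ fun μ hμ => ?_
    have h4 : 0 < ‖μ‖ := norm_pos_iff.2 (hM μ hμ).1
    have h5 : 1 ≤ R / ‖μ‖ := (one_le_div h4).2 (hM μ hμ).2
    rw [Real.posLog_eq_log (by rwa [abs_of_nonneg (by positivity)]), add_comm (Real.log _),
      ← Real.log_mul two_ne_zero (by positivity)]
    exact Real.log_le_log (by positivity) (by linarith)
  have h4 := card_mul_log_two_le hR hM hk hk0 h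
  have h5 := circleAverage_log_norm_le_posLog hf 0 (2 * R)
  rw [circleAverage_log_norm_rootPoly (fun μ hμ => (hM μ hμ).1) hR] at h1
  linarith

/-- On the circle `R² = z z̄`, so `1 - z²/R² = z (z̄ - z)/R²`. This trades a factor `|Im z|` for the
modulus of a polynomial, making estimates with that factor accessible to Jensen's formula and the
maximum principle. -/
theorem norm_rootPoly_pair {R : ℝ} (hR : 0 < R) {z : ℂ} (hz : ‖z‖ = R) :
    ‖rootPoly {(R : ℂ), -(R : ℂ)} z‖ = 2 * |z.im| / R := by
  have hR0 : (R : ℂ) ≠ 0 := by exact_mod_cast hR.ne'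
  have h2 : rootPoly {(R : ℂ), -(R : ℂ)} z = z * ((starRingEnd ℂ) z - z) / ((R : ℂ) * R) := by
    have h3 : (R : ℂ) * R = z * (starRingEnd ℂ) z := by
      rw [Complex.mul_conj, normSq_eq_norm_sq, hz]; push_cast; ring
    rw [mul_sub, ← h3]
    simp only [rootPoly, Multiset.insert_eq_cons, Multiset.map_cons, Multiset.map_singleton,
      Multiset.prod_cons, Multiset.prod_singleton]
    field_simp
    ring
  have h4 : ‖(starRingEnd ℂ) z - z‖ = 2 * |z.im| := by
    rw [norm_sub_rev, Complex.sub_conj, norm_mul, Complex.norm_I, mul_one, Complex.norm_real,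
      Real.norm_eq_abs, abs_mul, abs_two]
  rw [h2, norm_div, norm_mul, norm_mul, h4, Complex.norm_real, Real.norm_eq_abs, abs_of_pos hR, hz]
  field_simp

end Factorization

/-! ### Zero mean type and approximation by canonical products. -/

section CanonicalApproximation

open Metric Complex

/-- `log |k|` is harmonic on the disc, and for `‖w‖ < R / 2` the Poisson kernel is at most `(R +
‖w‖)/(R - ‖w‖) ≤ 3`. -/
theorem log_norm_le_three_mul_circleAverage {k : ℂ → ℂ} (hk : Differentiable ℂ k) {R : ℝ}
    (hne : ∀ z ∈ closedBall (0 : ℂ) R, k z ≠ 0) {w : ℂ} (hw : ‖w‖ < R / 2) :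
    Real.log ‖k w‖ ≤ 3 * Real.circleAverage (fun z => Real.posLog ‖k z‖) 0 R := by
  have hR : 0 < R := by linarith [norm_nonneg w]
  have hwb : w ∈ ball (0 : ℂ) R := by rw [mem_ball_zero_iff]; linarith
  have hharm : InnerProductSpace.HarmonicOnNhd (fun z => Real.log ‖k z‖) (closedBall 0 R) :=
    fun z hz => (hk.analyticAt z).harmonicAt_log_norm (hne z hz)
  have h1 := hharm.circleAverage_re_herglotzRieszKernel_smul hwb
  rw [← h1, ← smul_eq_mul, ← Real.circleAverage_fun_smul]
  have hker : ∀ z ∈ sphere (0 : ℂ) |R|, 0 ≤ (herglotzRieszKernel 0 w z).re ∧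
      (herglotzRieszKernel 0 w z).re ≤ 3 := by
    intro z hz
    rw [abs_of_pos hR] at hz
    have h2 := re_herglotzRieszKernel_le hz hwb
    have h3 := le_re_herglotzRieszKernel hz hwb
    rw [herglotzRieszKernel_def]
    simp only [sub_zero] at h2 h3 ⊢
    refine ⟨le_trans ?_ h3, h2.trans ?_⟩
    · exact div_nonneg (by linarith) (by linarith [norm_nonneg w])
    · rw [div_le_iff₀ (by linarith)]; linarith
  refine Real.circleAverage_mono ?_ ?_ fun z hz => ?_
  · refine ContinuousOn.circleIntegrable' ?_
    intro z hz
    have hz' : ‖z‖ = R := by simpa [abs_of_pos hR] using hz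
    have hzw : z - w ≠ 0 := by
      rw [sub_ne_zero]; rintro rfl; linarith
    have hkz : ‖k z‖ ≠ 0 := norm_ne_zero_iff.2 (hne z (by simp [hz']))
    refine ContinuousAt.continuousWithinAt ?_
    refine ContinuousAt.smul (f := Complex.re ∘ herglotzRieszKernel 0 w)
      (g := fun z => Real.log ‖k z‖) ?_ ?_
    · rw [herglotzRieszKernel_fun_def]
      simp only [sub_zero]
      exact Complex.continuous_re.continuousAt.comp
        (ContinuousAt.div (by fun_prop) (by fun_prop) hzw)
    · exact (hk.continuous.norm.continuousAt).log hkz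
  · exact (circleIntegrable_posLog_norm hk 0 R).const_smul
  · obtain ⟨h2, h3⟩ := hker z hz
    simp only [Pi.smul_apply', Function.comp_apply, smul_eq_mul]
    have h4 : Real.log ‖k z‖ ≤ Real.posLog ‖k z‖ := by simp [Real.posLog]
    have h5 : 0 ≤ Real.posLog ‖k z‖ := Real.posLog_nonneg
    nlinarith

/-- A holomorphic logarithm of `k` has real part at most `3 * M` on the half disc, and
Borel–Carathéodory turns this into a bound on its modulus. -/
theorem norm_sub_one_le_of_ne_zero {k : ℂ → ℂ} (hk : Differentiable ℂ k) (hk0 : k 0 = 1) {R : ℝ}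
    (hne : ∀ z ∈ closedBall (0 : ℂ) R, k z ≠ 0) {M : ℝ} (hM : 0 < M)
    (hkM : Real.circleAverage (fun z => Real.posLog ‖k z‖) 0 R ≤ M) {w : ℂ} (hw : ‖w‖ < R / 2) :
    ‖k w - 1‖ ≤ Real.exp (6 * M * ‖w‖ / (R / 2 - ‖w‖)) - 1 := by
  have hR : 0 < R / 2 := (norm_nonneg w).trans_lt hw
  have hsub : ball (0 : ℂ) (R / 2) ⊆ closedBall 0 R := fun z hz => by
    rw [mem_ball_zero_iff] at hz; rw [mem_closedBall_zero_iff]; linarith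
  have hharm : InnerProductSpace.HarmonicOnNhd (fun z => Real.log ‖k z‖) (ball 0 (R / 2)) :=
    fun z hz => (hk.analyticAt z).harmonicAt_log_norm (hne z (hsub hz))
  obtain ⟨F, hF, hFre⟩ := hharm.exists_analyticOnNhd_ball_re_eq
  have h0mem : (0 : ℂ) ∈ ball (0 : ℂ) (R / 2) := by simpa using hR
  have hF0re : (F 0).re = 0 := by have := hFre h0mem; simpa [hk0] using this
  have hFd : DifferentiableOn ℂ F (ball 0 (R / 2)) := hF.differentiableOn
  -- `F` only satisfies `Re F = log |k|`. The function `g` has modulus one, so it is constant by the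
  -- maximum principle, which gives `k = exp (F - F 0)`.
  set g : ℂ → ℂ := fun z => k z * Complex.exp (F 0 - F z) with hg
  have hgd : DifferentiableOn ℂ g (ball 0 (R / 2)) :=
    hk.differentiableOn.mul ((hFd.const_sub (F 0)).cexp)
  have hgn : ∀ z ∈ ball (0 : ℂ) (R / 2), ‖g z‖ = 1 := by
    intro z hz
    have h1 : (F z).re = Real.log ‖k z‖ := hFre hz
    have h2 : 0 < ‖k z‖ := norm_pos_iff.2 (hne z (hsub hz))
    rw [hg]
    simp only [norm_mul, Complex.norm_exp, Complex.sub_re, hF0re, h1, zero_sub, Real.exp_neg,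
      Real.exp_log h2]
    exact mul_inv_cancel₀ h2.ne'
  have hg1 : ∀ z ∈ ball (0 : ℂ) (R / 2), g z = 1 := by
    intro z hz
    have h1 : IsMaxOn (norm ∘ g) (ball 0 (R / 2)) 0 := fun y hy => by
      simp [hgn y hy, hgn 0 h0mem]
    have h2 := Complex.eqOn_of_isPreconnected_of_isMaxOn_norm
      (convex_ball (0 : ℂ) (R / 2)).isPreconnected isOpen_ball hgd h0mem h1 hz
    rw [h2]; simp [hg, hk0]
  have hwb : w ∈ ball (0 : ℂ) (R / 2) := by simpa using hw
  have hkw : k w = Complex.exp (F w - F 0) := by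
    have h1 := hg1 w hwb
    rw [hg] at h1
    simp only at h1
    rw [← neg_sub, Complex.exp_neg, mul_inv_eq_one₀ (Complex.exp_ne_zero _)] at h1
    exact h1
  have hbc : ‖F w - F 0‖ ≤ 2 * (3 * M) * ‖w‖ / (R / 2 - ‖w‖) := by
    refine borelCaratheodory_zero (f := fun z => F z - F 0) (by positivity)
      (hFd.sub_const _) (fun z hz => ?_) hR hwb (sub_self _)
    have h1 : (F z).re = Real.log ‖k z‖ := hFre hz
    have h2 := log_norm_le_three_mul_circleAverage hk hne (w := z) (by simpa using hz)
    simp only [Set.mem_ofPred_eq, Complex.sub_re, hF0re, h1]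
    linarith
  rw [hkw]
  have h3 := Complex.norm_exp_sub_sum_le_exp_norm_sub_sum (F w - F 0) 1
  simp only [Finset.range_one, Finset.sum_singleton, pow_zero, Nat.factorial_zero, Nat.cast_one,
    div_one] at h3
  refine h3.trans (sub_le_sub_right (Real.exp_le_exp.2 (hbc.trans (le_of_eq (by ring)))) 1)

/-- The growth condition `∫ log⁺ |f(R e^{iθ})| dθ = o(R)`. -/
def HasZeroMeanType (f : ℂ → ℂ) : Prop :=
  ∀ ε : ℝ, 0 < ε → ∀ᶠ R : ℝ in atTop,
    Real.circleAverage (fun z => Real.posLog ‖f z‖) 0 R ≤ ε * R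

theorem IsEntireTypeZero.hasZeroMeanType {f : ℂ → ℂ} (hf : IsEntireTypeZero f) :
    HasZeroMeanType f := by
  intro ε hε
  obtain ⟨C, hC⟩ := hf.2 (ε / 2) (by positivity)
  filter_upwards [eventually_ge_atTop (Real.posLog C * 2 / ε), eventually_ge_atTop 0]
    with R hR hR0
  refine Real.circleAverage_mono_on_of_le_circle (circleIntegrable_posLog_norm hf.1 0 R)
    fun z hz => ?_
  have hz' : ‖z‖ = R := by simpa [abs_of_nonneg hR0] using hz
  have h1 := (Real.posLog_le_posLog (norm_nonneg _) (hC z)).trans Real.posLog_mul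
  have h2 : Real.posLog (Real.exp (ε / 2 * ‖z‖)) = ε / 2 * R := by
    rw [hz', Real.posLog_apply, Real.log_exp]; exact max_eq_right (by positivity)
  rw [div_le_iff₀ hε] at hR
  rw [h2] at h1
  linarith

/-- An entire function of zero mean type is locally approximated by its canonical products. -/
theorem HasZeroMeanType.exists_rootPoly_mul {f : ℂ → ℂ} (hT : HasZeroMeanType f)
    (hf : Differentiable ℂ f) (h0 : f 0 = 1) {r ε : ℝ} (hr : 0 < r) (hε : 0 < ε) :
    ∃ (M : Multiset ℂ) (k : ℂ → ℂ), (∀ μ ∈ M, μ ≠ 0) ∧ Differentiable ℂ k ∧ k 0 = 1 ∧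
      (∀ z, f z = rootPoly M z * k z) ∧ ∀ z, ‖z‖ ≤ r → ‖k z - 1‖ ≤ ε := by
  -- Below, the cofactor average is at most `d R + d (2 R) = 3 d R`. With `‖z‖ ≤ r ≤ R / 4` the
  -- exponent `6 (3 d R) ‖z‖ / (R / 2 - ‖z‖)` is at most `72 d r`.
  obtain ⟨d, hd, hdε⟩ : ∃ d : ℝ, 0 < d ∧ Real.exp (72 * d * r) - 1 ≤ ε := by
    have h1 : Tendsto (fun d : ℝ => Real.exp (72 * d * r) - 1) (𝓝[>] 0) (𝓝 0) := by
      have : Continuous fun d : ℝ => Real.exp (72 * d * r) - 1 := by fun_prop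
      have h2 := this.tendsto 0
      simp only [mul_zero, zero_mul, Real.exp_zero, sub_self] at h2
      exact h2.mono_left nhdsWithin_le_nhds
    obtain ⟨d, hd, hd2⟩ := ((h1.eventually_le_const hε).and self_mem_nhdsWithin).exists
    exact ⟨d, hd2, hd⟩
  have hT1 := hT d hd
  have hT2 : ∀ᶠ R : ℝ in atTop,
      Real.circleAverage (fun z => Real.posLog ‖f z‖) 0 (2 * R) ≤ d * (2 * R) :=
    (tendsto_id.const_mul_atTop two_pos).eventually hT1
  obtain ⟨R, hR1, hR2, hR3⟩ := (hT1.and (hT2.and (eventually_ge_atTop (4 * r)))).exists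
  have hR : 0 < R := by linarith
  obtain ⟨M, k, hM, hk, hk0, hfk, hne⟩ := _root_.exists_rootPoly_mul hf h0 hR
  refine ⟨M, k, fun μ hμ => (hM μ hμ).1, hk, hk0, hfk, fun z hz => ?_⟩
  have h1 : Real.circleAverage (fun z => Real.posLog ‖k z‖) 0 R ≤ 3 * d * R := by
    have := circleAverage_posLog_cofactor_rootPoly_le hR hM hf hk hk0 hfk
    linarith
  refine (norm_sub_one_le_of_ne_zero hk hk0 hne (M := 3 * d * R) (by positivity) h1
    (by linarith)).trans (le_trans (sub_le_sub_right (Real.exp_le_exp.2 ?_) 1) hdε)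
  rw [div_le_iff₀ (by linarith)]
  have h2 : 6 * (3 * d * R) * ‖z‖ ≤ 18 * d * R * r := by
    have : 0 ≤ 18 * d * R := by positivity
    nlinarith
  have h3 : 72 * d * r * (R / 4) ≤ 72 * d * r * (R / 2 - ‖z‖) :=
    mul_le_mul_of_nonneg_left (by linarith) (by positivity)
  linarith

/-- Without zeros every approximating root polynomial is empty, so `f` is arbitrarily close to `1`.
-/
theorem HasZeroMeanType.eq_one {f : ℂ → ℂ} (hT : HasZeroMeanType f)
    (hf : Differentiable ℂ f) (h0 : f 0 = 1) (hne : ∀ z, f z ≠ 0) (w : ℂ) : f w = 1 := by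
  have h : ∀ ε : ℝ, 0 < ε → ‖f w - 1‖ ≤ 0 + ε := by
    intro ε hε
    obtain ⟨M, k, hM, hk, hk0, hfk, hk1⟩ :=
      hT.exists_rootPoly_mul hf h0 (r := ‖w‖ + 1) (by positivity) hε
    have hM0 : M = 0 := by
      refine Multiset.eq_zero_of_forall_notMem fun μ hμ => hne μ ?_
      obtain ⟨N, rfl⟩ := Multiset.exists_cons_of_mem hμ
      rw [hfk, rootPoly_cons, div_self (hM μ hμ)]; simp
    rw [hfk, hM0, rootPoly_empty, one_mul, zero_add]
    exact hk1 w (by linarith)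
  have h2 := le_of_forall_pos_le_add h
  exact sub_eq_zero.1 (norm_le_zero_iff.1 h2)

end CanonicalApproximation

/-! ### Reality of zeros and symmetry under conjugation. -/

section RealZeros

open Metric Complex

theorem hasDerivAt_rootPoly_zero (M : Multiset ℂ) :
    HasDerivAt (rootPoly M) (M.map fun μ => -μ⁻¹).sum 0 := by
  induction M using Multiset.induction with
  | empty => simp only [funext rootPoly_empty]; simpa using hasDerivAt_const (0 : ℂ) (1 : ℂ)
  | cons μ M ih =>
    have h1 : HasDerivAt (fun z : ℂ => 1 - z / μ) (-μ⁻¹) 0 := by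
      simpa [neg_div] using ((hasDerivAt_id (0 : ℂ)).div_const μ).const_sub 1
    have h2 := h1.fun_mul ih
    simp only [funext (rootPoly_cons μ M)]
    simpa [rootPoly_zero] using h2

theorem rootPoly_eq_zero {M : Multiset ℂ} {z : ℂ} (h : rootPoly M z = 0) : z ∈ M := by
  obtain ⟨μ, hμ, h1⟩ := Multiset.mem_map.1 (Multiset.prod_eq_zero_iff.1 h)
  have h2 : z / μ = 1 := (sub_eq_zero.1 h1).symm
  have h3 : μ ≠ 0 := by rintro rfl; simp at h2
  rw [div_eq_one_iff_eq h3] at h2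
  rwa [h2]

theorem rootPoly_eq_zero_of_mem {M : Multiset ℂ} {μ : ℂ} (h : μ ∈ M) (h0 : μ ≠ 0) :
    rootPoly M μ = 0 := by
  obtain ⟨N, rfl⟩ := Multiset.exists_cons_of_mem h
  rw [rootPoly_cons, div_self h0]; simp

theorem ne_zero_of_norm_sub_one_le {a : ℂ} {ε : ℝ} (h : ‖a - 1‖ ≤ ε) (hε : ε < 1) : a ≠ 0 := by
  rintro rfl; simp at h; linarith

/-- An entire function of zero mean type without zeros in the upper half-plane has only real
zeros as soon as its derivative at the origin has nonnegative imaginary part. -/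
theorem HasZeroMeanType.im_eq_zero {f : ℂ → ℂ} (hT : HasZeroMeanType f)
    (hf : Differentiable ℂ f) (h0 : f 0 = 1) (hz : ∀ z, f z = 0 → z.im ≤ 0)
    (hd : 0 ≤ (deriv f 0).im) {a : ℂ} (ha : f a = 0) : a.im = 0 := by
  have ha0 : a ≠ 0 := by rintro rfl; simp [h0] at ha
  have key : ∀ ε : ℝ, 0 < ε → -(a.im / normSq a) ≤ 0 + ε := by
    intro ε hε
    have hr : 0 < ‖a‖ + 1 := by positivity
    obtain ⟨M, k, hM, hk, hk0, hfk, hk1⟩ := hT.exists_rootPoly_mul hf h0 hr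
      (lt_min hε (one_half_pos : (0 : ℝ) < 1 / 2))
    have haM : a ∈ M := by
      have h1 := hk1 a (by linarith)
      have h2 := ne_zero_of_norm_sub_one_le h1 ((min_le_right _ _).trans_lt one_half_lt_one)
      rw [hfk] at ha
      exact rootPoly_eq_zero ((mul_eq_zero.1 ha).resolve_right h2)
    have hdk : ‖deriv k 0‖ ≤ ε := by
      have h1 : deriv (fun z => k z - 1) 0 = deriv k 0 := by simp
      rw [← h1]
      refine (Complex.norm_deriv_le_of_forall_mem_sphere_norm_le hr
        (hk.sub_const 1).diffContOnCl fun z hz => hk1 z ?_).trans ?_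
      · simpa using (le_of_eq (by simpa using hz) : ‖z‖ ≤ ‖a‖ + 1)
      · rw [div_le_iff₀ hr]
        have : min ε (1 / 2) ≤ ε := min_le_left _ _
        nlinarith [norm_nonneg a]
    -- Up to `deriv k 0`, of size at most `ε`, the derivative is `-∑ 1/μ`. All imaginary parts `μ.im
    -- / normSq μ` of its terms are nonpositive, so a nonnegative total leaves each of them at least
    -- `-ε`.
    have hdf : deriv f 0 = (M.map fun μ => -μ⁻¹).sum + deriv k 0 := by
      have h1 := (hasDerivAt_rootPoly_zero M).fun_mul (hk 0).hasDerivAt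
      rw [hk0, rootPoly_zero, mul_one, one_mul] at h1
      rw [show f = fun z => rootPoly M z * k z from funext hfk]
      exact h1.deriv
    have him : ∀ μ : ℂ, (-μ⁻¹).im = μ.im / normSq μ := fun μ => by
      rw [neg_im, inv_im, neg_div, neg_neg]
    obtain ⟨N, rfl⟩ := Multiset.exists_cons_of_mem haM
    have hN : (N.map fun μ => -μ⁻¹).sum.im ≤ 0 := by
      have h2 : (N.map fun μ => -μ⁻¹).sum.im = (N.map fun μ => (-μ⁻¹).im).sum := by
        have := map_multiset_sum Complex.imAddGroupHom (N.map fun μ => -μ⁻¹)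
        simpa [Multiset.map_map] using this
      rw [h2]
      refine (Multiset.sum_le_card_nsmul _ 0 fun x hx => ?_).trans (smul_zero _).le
      obtain ⟨μ, hμ, rfl⟩ := Multiset.mem_map.1 hx
      rw [him]
      refine div_nonpos_of_nonpos_of_nonneg (hz μ ?_) (normSq_nonneg _)
      have hμ' : μ ∈ a ::ₘ N := by simp [hμ]
      rw [hfk, rootPoly_eq_zero_of_mem hμ' (hM μ hμ'), zero_mul]
    rw [Multiset.map_cons, Multiset.sum_cons] at hdf
    rw [hdf, add_im, add_im, him] at hd
    have h5 := (Complex.abs_im_le_norm (deriv k 0)).trans hdk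
    linarith [le_abs_self (deriv k 0).im]
  have h1 := le_of_forall_pos_le_add key
  have h2 : 0 ≤ a.im / normSq a := by linarith
  have h3 := mul_nonneg h2 (normSq_nonneg a)
  rw [div_mul_cancel₀ _ (normSq_pos.2 ha0).ne'] at h3
  exact le_antisymm (hz a ha) h3

theorem rootPoly_conj {M : Multiset ℂ} (hM : ∀ μ ∈ M, μ.im = 0) (z : ℂ) :
    rootPoly M ((starRingEnd ℂ) z) = (starRingEnd ℂ) (rootPoly M z) := by
  induction M using Multiset.induction with
  | empty => simp [rootPoly_empty]
  | cons μ M ih =>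
    rw [rootPoly_cons, rootPoly_cons, ih fun ν hν => hM ν (by simp [hν]), map_mul, map_sub, map_one,
      map_div₀, Complex.conj_eq_iff_im.2 (hM μ (by simp))]

/-- The approximating root polynomials have real roots and commute with conjugation; only the nearly
constant cofactor has to be estimated. -/
theorem HasZeroMeanType.map_conj {f : ℂ → ℂ} (hT : HasZeroMeanType f)
    (hf : Differentiable ℂ f) (h0 : f 0 = 1) (hz : ∀ z, f z = 0 → z.im = 0) (w : ℂ) :
    f ((starRingEnd ℂ) w) = (starRingEnd ℂ) (f w) := by
  have key : ∀ ε : ℝ, 0 < ε → ‖f ((starRingEnd ℂ) w) - (starRingEnd ℂ) (f w)‖ ≤ 0 + ε := by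
    intro ε hε
    set d := min (ε / (4 * (‖f w‖ + 1))) (1 / 2) with hd
    have hd0 : 0 < d := lt_min (by positivity) one_half_pos
    have hd2 : d ≤ 1 / 2 := min_le_right _ _
    obtain ⟨M, k, hM, hk, hk0, hfk, hk1⟩ := hT.exists_rootPoly_mul hf h0 (r := ‖w‖ + 1)
      (by positivity) hd0
    have hMr : ∀ μ ∈ M, μ.im = 0 := fun μ hμ =>
      hz μ (by rw [hfk, rootPoly_eq_zero_of_mem hμ (hM μ hμ), zero_mul])
    have h1 : ‖k w - 1‖ ≤ d := hk1 w (by linarith)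
    have h2 : ‖k ((starRingEnd ℂ) w) - 1‖ ≤ d := hk1 _ (by rw [Complex.norm_conj]; linarith)
    have h3 : ‖(starRingEnd ℂ) (k w) - 1‖ ≤ d := by
      rw [← Complex.norm_conj, map_sub, Complex.conj_conj, map_one]; exact h1
    have h4 : ‖k ((starRingEnd ℂ) w) - (starRingEnd ℂ) (k w)‖ ≤ 2 * d := by
      have := norm_sub_le (k ((starRingEnd ℂ) w) - 1) ((starRingEnd ℂ) (k w) - 1)
      rw [sub_sub_sub_cancel_right] at this
      linarith
    have h5 : 1 / 2 ≤ ‖k w‖ := by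
      have := norm_sub_norm_le (1 : ℂ) (1 - k w)
      rw [sub_sub_cancel, norm_one, norm_sub_rev] at this
      linarith
    have h6 : ‖rootPoly M w‖ ≤ 2 * ‖f w‖ := by
      rw [hfk, norm_mul]; nlinarith [norm_nonneg (rootPoly M w)]
    have h7 : d * (4 * (‖f w‖ + 1)) ≤ ε := by
      rw [← le_div_iff₀ (by positivity)]; exact min_le_left _ _
    rw [hfk, hfk w, rootPoly_conj hMr, map_mul, ← mul_sub, norm_mul, Complex.norm_conj, zero_add]
    calc ‖rootPoly M w‖ * ‖k ((starRingEnd ℂ) w) - (starRingEnd ℂ) (k w)‖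
        ≤ (2 * ‖f w‖) * (2 * d) := mul_le_mul h6 h4 (norm_nonneg _) (by positivity)
      _ ≤ ε := by nlinarith [norm_nonneg (f w)]
  exact sub_eq_zero.1 (norm_le_zero_iff.1 (le_of_forall_pos_le_add key))

end RealZeros

/-! ### From integrated zero counts to growth. -/

section CountingComparison

open Metric Complex

open MeasureTheory

theorem posLog_le_self_of_nonneg {x : ℝ} (hx : 0 ≤ x) : Real.posLog x ≤ x := by
  rw [Real.posLog_apply]; exact max_le hx (Real.log_le_self hx)

theorem lintegral_posLog_kernel {r t : ℝ} (hr : 0 < r) (ht : 0 < t) :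
    ∫⁻ s in Set.Ioi (0 : ℝ), ENNReal.ofReal (Real.posLog (s / t) * (r / (s + r) ^ 2)) =
      ENNReal.ofReal (Real.log (1 + r / t)) := by
  -- The antiderivative from integration by parts, normalized to vanish at infinity, so that the
  -- integral over `s > t` is `-A t`.
  set A : ℝ → ℝ := fun s => Real.log s - Real.log (s + r) -
    r * ((Real.log s - Real.log t) / (s + r)) with hA
  have hderiv : ∀ s ∈ Set.Ici t, HasDerivAt A (Real.log (s / t) * (r / (s + r) ^ 2)) s := by
    intro s hs
    have hs0 : 0 < s := ht.trans_le hs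
    have hsr : s + r ≠ 0 := by positivity
    have h1 : HasDerivAt (fun s => s + r) 1 s := (hasDerivAt_id s).add_const r
    have h2 : HasDerivAt (fun s => Real.log s - Real.log t) s⁻¹ s :=
      (Real.hasDerivAt_log hs0.ne').sub_const _
    have h3 := ((Real.hasDerivAt_log hs0.ne').sub (h1.log hsr)).sub
      ((h2.div h1 hsr).const_mul r)
    refine h3.congr_deriv ?_
    rw [Real.log_div hs0.ne' ht.ne']
    field_simp
    ring
  have hnonneg : ∀ s ∈ Set.Ioi t, 0 ≤ Real.log (s / t) * (r / (s + r) ^ 2) := by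
    intro s hs
    have : 1 ≤ s / t := (one_le_div ht).2 (le_of_lt hs)
    exact mul_nonneg (Real.log_nonneg this) (by positivity)
  have hlim : Tendsto A atTop (𝓝 0) := by
    have h1 : Tendsto (fun s : ℝ => Real.log s / (s + r)) atTop (𝓝 0) := by
      simpa using Real.tendsto_pow_log_div_mul_add_atTop 1 r 1 one_ne_zero
    have h2 : Tendsto (fun s : ℝ => Real.log t / (s + r)) atTop (𝓝 0) :=
      Tendsto.div_atTop tendsto_const_nhds (tendsto_atTop_add_const_right _ _ tendsto_id)
    have h3 : Tendsto (fun s : ℝ => Real.log s - Real.log (s + r)) atTop (𝓝 0) := by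
      have h4 : Tendsto (fun s : ℝ => r / s) atTop (𝓝 0) :=
        Tendsto.div_atTop tendsto_const_nhds tendsto_id
      have h5 : Tendsto (fun s : ℝ => -Real.log (1 + r / s)) atTop (𝓝 0) := by
        have := ((h4.const_add 1).log (by norm_num)).neg
        simpa using this
      refine h5.congr' ?_
      filter_upwards [eventually_gt_atTop 0] with s hs
      have : 1 + r / s = (s + r) / s := by field_simp
      rw [this, Real.log_div (by positivity) hs.ne']; ring
    have h6 := h3.sub ((h1.sub h2).const_mul r)
    simp only [sub_zero, mul_zero] at h6
    refine h6.congr fun s => ?_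
    rw [hA]; simp only [sub_div]
  have hint := integrableOn_Ioi_deriv_of_nonneg' hderiv hnonneg hlim
  have hval := integral_Ioi_of_hasDerivAt_of_nonneg' hderiv hnonneg hlim
  have hAt : 0 - A t = Real.log (1 + r / t) := by
    have : 1 + r / t = (t + r) / t := by field_simp
    rw [hA, this, Real.log_div (by positivity) ht.ne']; simp
  rw [← hAt, ← hval, ofReal_integral_eq_lintegral_ofReal hint
    ((ae_restrict_iff' measurableSet_Ioi).2 (ae_of_all _ hnonneg)),
    ← lintegral_indicator measurableSet_Ioi, ← lintegral_indicator measurableSet_Ioi]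
  congr 1
  funext s
  by_cases hs : t < s
  · have : 1 ≤ s / t := (one_le_div ht).2 hs.le
    rw [Set.indicator_of_mem (show s ∈ Set.Ioi 0 from ht.trans hs), Set.indicator_of_mem
      (show s ∈ Set.Ioi t from hs), Real.posLog_eq_log (by rwa [abs_of_nonneg (by positivity)])]
  · rw [Set.indicator_of_notMem (show s ∉ Set.Ioi t from hs)]
    by_cases h0 : 0 < s
    · rw [Set.indicator_of_mem (show s ∈ Set.Ioi 0 from h0), (Real.posLog_eq_zero_iff _).2]
      · simp
      · rw [abs_of_nonneg (by positivity)]; exact (div_le_one ht).2 (not_lt.1 hs)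
    · rw [Set.indicator_of_notMem (show s ∉ Set.Ioi 0 from h0)]

theorem lintegral_kernel {r : ℝ} (hr : 0 < r) :
    ∫⁻ s in Set.Ioi (0 : ℝ), ENNReal.ofReal (r / (s + r) ^ 2) = 1 := by
  have hderiv : ∀ s ∈ Set.Ici (0 : ℝ),
      HasDerivAt (fun s => -(r / (s + r))) (r / (s + r) ^ 2) s := by
    intro s hs
    have hsr : s + r ≠ 0 := by have : 0 ≤ s := hs; positivity
    have h1 : HasDerivAt (fun s => s + r) 1 s := (hasDerivAt_id s).add_const r
    refine (((hasDerivAt_const s r).div h1 hsr).neg).congr_deriv ?_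
    field_simp; ring
  have hnonneg : ∀ s ∈ Set.Ioi (0 : ℝ), 0 ≤ r / (s + r) ^ 2 := fun s _ => by positivity
  have hlim : Tendsto (fun s : ℝ => -(r / (s + r))) atTop (𝓝 0) := by
    have : Tendsto (fun s : ℝ => r / (s + r)) atTop (𝓝 0) :=
      Tendsto.div_atTop tendsto_const_nhds (tendsto_atTop_add_const_right _ _ tendsto_id)
    simpa using this.neg
  have hint := integrableOn_Ioi_deriv_of_nonneg' hderiv hnonneg hlim
  have hval := integral_Ioi_of_hasDerivAt_of_nonneg' hderiv hnonneg hlim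
  rw [← ofReal_integral_eq_lintegral_ofReal hint
    ((ae_restrict_iff' measurableSet_Ioi).2 (ae_of_all _ hnonneg)), hval]
  simp [hr.ne']

theorem summable_log_one_add_div {ι : Type*} {b : ι → ℝ} (hb : ∀ i, 0 < b i)
    (hs : Summable fun i => 1 / b i) {r : ℝ} (hr : 0 ≤ r) :
    Summable fun i => Real.log (1 + r / b i) := by
  refine Summable.of_nonneg_of_le (fun i => Real.log_nonneg ?_) (fun i => ?_) (hs.mul_left r)
  · have : 0 ≤ r / b i := div_nonneg hr (hb i).le
    linarith
  · have : 0 ≤ r / b i := div_nonneg hr (hb i).le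
    have := Real.log_le_sub_one_of_pos (by linarith : 0 < 1 + r / b i)
    rw [mul_one_div]; linarith

theorem summable_posLog_div {ι : Type*} {b : ι → ℝ} (hb : ∀ i, 0 < b i)
    (hs : Summable fun i => 1 / b i) {s : ℝ} (hs0 : 0 ≤ s) :
    Summable fun i => Real.posLog (s / b i) := by
  refine Summable.of_nonneg_of_le (fun i => Real.posLog_nonneg) (fun i => ?_) (hs.mul_left s)
  rw [mul_one_div]
  exact posLog_le_self_of_nonneg (div_nonneg hs0 (hb i).le)

/-- The hypothesis is integrated against the probability density `r / (s + r) ^ 2`, which turns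
`log⁺ (s / t)` into `log (1 + r / t)`. Lower integrals allow sum and integral to be exchanged
without an integrability check. -/
theorem sum_log_one_add_div_le {ι : Type*} [Countable ι] {b : ι → ℝ} (hb : ∀ i, 0 < b i)
    (hs : Summable fun i => 1 / b i) {M : Multiset ℂ} (hM : ∀ μ ∈ M, μ ≠ 0) {c : ℝ} (hc : 0 ≤ c)
    (h : ∀ s : ℝ, 0 < s → (M.map fun μ => Real.posLog (s / ‖μ‖)).sum ≤
      c + ∑' i, Real.posLog (s / b i)) {r : ℝ} (hr : 0 < r) :
    (M.map fun μ => Real.log (1 + r / ‖μ‖)).sum ≤ c + ∑' i, Real.log (1 + r / b i) := by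
  have hmeas : ∀ t : ℝ, Measurable fun s : ℝ =>
      ENNReal.ofReal (Real.posLog (s / t) * (r / (s + r) ^ 2)) := fun t => by
    have h1 : Measurable fun s : ℝ => Real.posLog (s / t) :=
      Real.continuous_posLog.measurable.comp (measurable_id.div_const t)
    fun_prop
  have hlhs : ∀ N : Multiset ℂ, (∀ μ ∈ N, μ ≠ 0) →
      ∫⁻ s in Set.Ioi (0 : ℝ), ENNReal.ofReal ((N.map fun μ => Real.posLog (s / ‖μ‖)).sum *
        (r / (s + r) ^ 2)) = ENNReal.ofReal (N.map fun μ => Real.log (1 + r / ‖μ‖)).sum := by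
    intro N hN
    induction N using Multiset.induction with
    | empty => simp
    | cons μ N ih =>
      have h1 : 0 < ‖μ‖ := norm_pos_iff.2 (hN μ (by simp))
      have h2 : ∀ s : ℝ, 0 ≤ (N.map fun μ => Real.posLog (s / ‖μ‖)).sum := fun s => by
        refine Multiset.sum_nonneg fun x hx => ?_
        obtain ⟨ν, _, rfl⟩ := Multiset.mem_map.1 hx
        exact Real.posLog_nonneg
      have h3 : 0 ≤ (N.map fun μ => Real.log (1 + r / ‖μ‖)).sum := by
        refine Multiset.sum_nonneg fun x hx => ?_
        obtain ⟨ν, _, rfl⟩ := Multiset.mem_map.1 hx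
        have : 0 ≤ r / ‖ν‖ := by positivity
        exact Real.log_nonneg (by linarith)
      have h4 : 0 ≤ r / ‖μ‖ := by positivity
      simp only [Multiset.map_cons, Multiset.sum_cons]
      rw [ENNReal.ofReal_add (Real.log_nonneg (by linarith)) h3,
        ← ih fun ν hν => hN ν (by simp [hν]), ← lintegral_posLog_kernel hr h1,
        ← lintegral_add_left (hmeas _)]
      refine lintegral_congr fun s => ?_
      rw [add_mul, ENNReal.ofReal_add (mul_nonneg Real.posLog_nonneg (by positivity))
        (mul_nonneg (h2 s) (by positivity))]
  have hlogs := summable_log_one_add_div hb hs hr.le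
  have hlog0 : ∀ i, 0 ≤ Real.log (1 + r / b i) := fun i => by
    have : 0 ≤ r / b i := div_nonneg hr.le (hb i).le
    exact Real.log_nonneg (by linarith)
  rw [← ENNReal.ofReal_le_ofReal_iff (add_nonneg hc (tsum_nonneg hlog0)), ← hlhs M hM,
    ENNReal.ofReal_add hc (tsum_nonneg hlog0), ENNReal.ofReal_tsum_of_nonneg hlog0 hlogs]
  simp only [← lintegral_posLog_kernel hr (hb _)]
  rw [← lintegral_tsum fun i => (hmeas (b i)).aemeasurable,
    ← mul_one (ENNReal.ofReal c), ← lintegral_kernel hr, ← lintegral_const_mul _ (by fun_prop),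
    ← lintegral_add_left (by fun_prop)]
  refine setLIntegral_mono' measurableSet_Ioi fun s hs0 => ?_
  have hs0' : 0 < s := hs0
  have hk : 0 ≤ r / (s + r) ^ 2 := by positivity
  have hsum := summable_posLog_div hb hs hs0'.le
  rw [← ENNReal.ofReal_mul hc, ← ENNReal.ofReal_tsum_of_nonneg
    (fun i => mul_nonneg Real.posLog_nonneg hk) (hsum.mul_right _), tsum_mul_right,
    ← ENNReal.ofReal_add (by positivity)
      (mul_nonneg (tsum_nonneg fun i => Real.posLog_nonneg) hk), ← add_mul]
  exact ENNReal.ofReal_le_ofReal (mul_le_mul_of_nonneg_right (h s hs0') hk)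

/-- Growth of an entire function of zero mean type in terms of its zeros. -/
theorem HasZeroMeanType.norm_le_of_sum_log_le {f : ℂ → ℂ} (hT : HasZeroMeanType f)
    (hf : Differentiable ℂ f) (h0 : f 0 = 1) {w : ℂ} {B : ℝ}
    (h : ∀ (M : Multiset ℂ) (k : ℂ → ℂ), (∀ μ ∈ M, μ ≠ 0) → Differentiable ℂ k → k 0 = 1 →
      (∀ z, f z = rootPoly M z * k z) → (M.map fun μ => Real.log (1 + ‖w‖ / ‖μ‖)).sum ≤ B) :
    ‖f w‖ ≤ 2 * Real.exp B := by
  obtain ⟨M, k, hM, hk, hk0, hfk, hk1⟩ := hT.exists_rootPoly_mul hf h0 (r := ‖w‖ + 1)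
    (by positivity) one_pos
  have h1 := (posLog_norm_rootPoly_le M w).trans (h M k hM hk hk0 hfk)
  have h2 : ‖rootPoly M w‖ ≤ Real.exp B := by
    rcases eq_or_ne ‖rootPoly M w‖ 0 with h3 | h3
    · rw [h3]; positivity
    · rw [← Real.log_le_iff_le_exp (lt_of_le_of_ne (norm_nonneg _) h3.symm)]
      exact le_trans (by simp [Real.posLog]) h1
  have h3 : ‖k w‖ ≤ 2 := by
    have := norm_add_le (k w - 1) 1
    rw [sub_add_cancel, norm_one] at this
    linarith [hk1 w (by linarith)]
  rw [hfk, norm_mul, mul_comm]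
  exact mul_le_mul h3 h2 (norm_nonneg _) (by norm_num)

end CountingComparison

/-! ### Growth and zeros of the product `W`. -/

section CanonicalProduct

open Metric Complex

variable {S : Set ℝ}

theorem Summable.subtype_mono {T : Set ℝ} {f : ℝ → ℝ} (hS : Summable fun s : S => f s)
    (h : T ⊆ S) : Summable fun s : T => f s :=
  hS.comp_injective (Set.inclusion_injective h)

theorem tsum_subtype_mono_of_nonneg {T : Set ℝ} {f : ℝ → ℝ} (hS : Summable fun s : S => f s)
    (h : T ⊆ S) (hf : ∀ s, 0 ≤ f s) : ∑' s : T, f s ≤ ∑' s : S, f s :=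
  Summable.tsum_le_tsum_of_inj (Set.inclusion h) (Set.inclusion_injective h)
    (fun s _ => hf s) (fun _ => le_rfl) (hS.subtype_mono h) hS

theorem Summable.one_div_abs_mono {T : Set ℝ} (hS : Summable fun s : S => 1 / |(s : ℝ)|)
    (h : T ⊆ S) : Summable fun s : T => 1 / |(s : ℝ)| :=
  Summable.subtype_mono (f := fun s => 1 / |s|) hS h

theorem countable_of_summable_one_div_abs (h0 : (0 : ℝ) ∉ S)
    (hS : Summable fun s : S => 1 / |(s : ℝ)|) : Countable S := by
  have h1 := hS.countable_support
  have h2 : Function.support (fun s : S => 1 / |(s : ℝ)|) = Set.univ := by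
    ext s
    have : (s : ℝ) ≠ 0 := fun h => h0 (h ▸ s.2)
    simpa using this
  rw [h2] at h1
  exact Set.countable_univ_iff.1 h1

theorem abs_pos_of_zero_notMem (h0 : (0 : ℝ) ∉ S) (s : S) : 0 < |(s : ℝ)| :=
  abs_pos.2 fun h => h0 (h ▸ s.2)

theorem differentiable_couplingW (hS : Summable fun s : S => 1 / |(s : ℝ)|) :
    Differentiable ℂ (couplingW S) := by
  intro z
  have h1 : HasProdLocallyUniformlyOn (fun (s : S) (w : ℂ) => 1 + -(w / ((s : ℝ) : ℂ)))
      (fun w => ∏' s : S, (1 + -(w / ((s : ℝ) : ℂ)))) (ball 0 (‖z‖ + 1)) := by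
    refine Summable.hasProdLocallyUniformlyOn_one_add isOpen_ball (hS.mul_left (‖z‖ + 1))
      (Eventually.of_forall fun s w hw => ?_) fun s => by fun_prop
    rw [norm_neg, norm_div, Complex.norm_real, Real.norm_eq_abs, ← div_eq_mul_one_div]
    rw [mem_ball_zero_iff] at hw
    gcongr
  have h2 : DifferentiableOn ℂ (fun w => ∏' s : S, (1 + -(w / ((s : ℝ) : ℂ))))
      (ball 0 (‖z‖ + 1)) := by
    refine TendstoLocallyUniformlyOn.differentiableOn h1 (Eventually.of_forall fun I => ?_)
      isOpen_ball
    exact DifferentiableOn.fun_finsetProd fun i _ => by fun_prop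
  have h3 := h2.differentiableAt (isOpen_ball.mem_nhds
    (show z ∈ ball (0 : ℂ) (‖z‖ + 1) by rw [mem_ball_zero_iff]; linarith))
  simp only [← sub_eq_add_neg] at h3
  exact h3

theorem couplingW_zero : couplingW S 0 = 1 := by simp [couplingW]

theorem couplingW_eq_zero_of_mem (h0 : (0 : ℝ) ∉ S) {s : ℝ} (hs : s ∈ S) :
    couplingW S (s : ℂ) = 0 := by
  have h1 : (s : ℂ) ≠ 0 := by
    rw [Complex.ofReal_ne_zero]; rintro rfl; exact h0 hs
  exact tprod_of_exists_eq_zero ⟨⟨s, hs⟩, by simp [div_self h1]⟩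

theorem couplingW_ne_zero (h0 : (0 : ℝ) ∉ S) (hS : Summable fun s : S => 1 / |(s : ℝ)|) {z : ℂ}
    (hz : ∀ s ∈ S, z ≠ ((s : ℝ) : ℂ)) : couplingW S z ≠ 0 := by
  have h1 := tprod_one_add_ne_zero_of_summable (f := fun s : S => -(z / ((s : ℝ) : ℂ)))
    (fun s => ?_) ?_
  · simp only [← sub_eq_add_neg] at h1
    exact h1
  · rw [← sub_eq_add_neg, sub_ne_zero]
    intro h
    have h2 : ((s : ℝ) : ℂ) ≠ 0 := by
      rw [Complex.ofReal_ne_zero]; exact fun h => h0 (h ▸ s.2)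
    exact hz s s.2 ((div_eq_one_iff_eq h2).1 h.symm)
  · refine (hS.mul_left ‖z‖).congr fun s => ?_
    rw [norm_neg, norm_div, Complex.norm_real, Real.norm_eq_abs, mul_one_div]

theorem couplingW_eq_zero_iff (h0 : (0 : ℝ) ∉ S) (hS : Summable fun s : S => 1 / |(s : ℝ)|)
    {z : ℂ} : couplingW S z = 0 ↔ ∃ s ∈ S, z = ((s : ℝ) : ℂ) := by
  constructor
  · intro h
    by_contra! h1
    exact couplingW_ne_zero h0 hS h1 h
  · rintro ⟨s, hs, rfl⟩; exact couplingW_eq_zero_of_mem h0 hs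

theorem couplingW_ne_zero_of_im (h0 : (0 : ℝ) ∉ S) (hS : Summable fun s : S => 1 / |(s : ℝ)|)
    {z : ℂ} (hz : z.im ≠ 0) : couplingW S z ≠ 0 :=
  couplingW_ne_zero h0 hS fun s _ h => hz (by rw [h]; simp)

theorem couplingW_union {A B : Set ℝ} (hd : Disjoint A B)
    (hA : Summable fun s : A => 1 / |(s : ℝ)|) (hB : Summable fun s : B => 1 / |(s : ℝ)|) (z : ℂ) :
    couplingW (A ∪ B) z = couplingW A z * couplingW B z :=
  Multipliable.tprod_union_disjoint (f := fun s : ℝ => 1 - z / (s : ℂ)) hd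
    (multipliable_couplingW hA z) (multipliable_couplingW hB z)

theorem couplingW_singleton (a : ℝ) (z : ℂ) : couplingW {a} z = 1 - z / (a : ℂ) :=
  tprod_singleton a fun s : ℝ => 1 - z / (s : ℂ)

theorem couplingW_conj (hS : Summable fun s : S => 1 / |(s : ℝ)|) (z : ℂ) :
    couplingW S ((starRingEnd ℂ) z) = (starRingEnd ℂ) (couplingW S z) := by
  have h1 := (multipliable_couplingW hS z).hasProd.map (starRingEnd ℂ) Complex.continuous_conj
  refine Eq.trans ?_ h1.tprod_eq
  refine tprod_congr fun s => ?_
  simp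

theorem couplingW_ofReal (hS : Summable fun s : S => 1 / |(s : ℝ)|) (x : ℝ) :
    couplingW S (x : ℂ) = ((∏' s : S, (1 - x / (s : ℝ)) : ℝ) : ℂ) := by
  have h : Summable fun s : S => ‖-(x / (s : ℝ))‖ := by
    refine (hS.mul_left |x|).congr fun s => ?_
    rw [norm_neg, norm_div, Real.norm_eq_abs, Real.norm_eq_abs, mul_one_div]
  have h1 : Multipliable fun s : S => 1 - x / (s : ℝ) := by
    simpa [sub_eq_add_neg] using multipliable_one_add_of_summable h
  have h2 := h1.hasProd.map Complex.ofRealHom Complex.continuous_ofReal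
  refine Eq.trans ?_ h2.tprod_eq
  refine tprod_congr fun s => ?_
  simp

theorem norm_couplingW_le (h0 : (0 : ℝ) ∉ S) (hS : Summable fun s : S => 1 / |(s : ℝ)|) (z : ℂ) :
    ‖couplingW S z‖ ≤ Real.exp (∑' s : S, Real.log (1 + ‖z‖ / |(s : ℝ)|)) := by
  have h1 := (multipliable_couplingW hS z).hasProd.norm
  have hlog := summable_log_one_add_div (abs_pos_of_zero_notMem h0) hS (norm_nonneg z)
  refine le_of_tendsto h1 (Eventually.of_forall fun I => ?_)
  have h2 : ∀ s : S, 0 ≤ ‖z‖ / |(s : ℝ)| := fun s => by positivity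
  calc ∏ s ∈ I, ‖1 - z / ((s : ℝ) : ℂ)‖
      ≤ ∏ s ∈ I, Real.exp (Real.log (1 + ‖z‖ / |(s : ℝ)|)) := by
        refine Finset.prod_le_prod (fun s _ => norm_nonneg _) fun s _ => ?_
        rw [Real.exp_log (by linarith [h2 s])]
        simpa using norm_sub_le (1 : ℂ) (z / ((s : ℝ) : ℂ))
    _ = Real.exp (∑ s ∈ I, Real.log (1 + ‖z‖ / |(s : ℝ)|)) := (Real.exp_sum _ _).symm
    _ ≤ _ := Real.exp_le_exp.2 (hlog.sum_le_tsum _ fun s _ =>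
        Real.log_nonneg (by linarith [h2 s]))

theorem exists_tsum_log_le (h0 : (0 : ℝ) ∉ S) (hS : Summable fun s : S => 1 / |(s : ℝ)|) {ε : ℝ}
    (hε : 0 < ε) :
    ∃ C : ℝ, ∀ r : ℝ, 0 ≤ r → ∑' s : S, Real.log (1 + r / |(s : ℝ)|) ≤ C + ε * r := by
  have hb := abs_pos_of_zero_notMem h0
  obtain ⟨I, hI⟩ := ((tendsto_order.1 (tendsto_tsum_compl_atTop_zero
    fun s : S => 1 / |(s : ℝ)|)).2 (ε / 2) (by positivity)).exists
  have hlin : ∀ (d x : ℝ), 0 < d → 0 ≤ x → Real.log (1 + x) ≤ d * (1 + x) - 1 - Real.log d := by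
    intro d x hd hx
    have h1 := Real.log_le_sub_one_of_pos (show 0 < d * (1 + x) by positivity)
    rw [Real.log_mul hd.ne' (by positivity)] at h1
    linarith
  -- Parameters of the bound `hlin`, chosen so that each of the finitely many terms in `I` grows
  -- with slope `ε / 2 / (I.card + 1)`; the tail is handled by `log (1 + x) ≤ x`.
  set d : S → ℝ := fun s => ε / 2 * |(s : ℝ)| / (I.card + 1) with hd
  have hd0 : ∀ s, 0 < d s := fun s => by have := hb s; positivity
  refine ⟨∑ s ∈ I, (d s - 1 - Real.log (d s)), fun r hr => ?_⟩
  have hlog := summable_log_one_add_div hb hS hr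
  rw [← hlog.sum_add_tsum_subtype_compl I]
  have hfin : ∑ s ∈ I, Real.log (1 + r / |(s : ℝ)|) ≤
      ∑ s ∈ I, (d s - 1 - Real.log (d s)) + ε / 2 * r := by
    have h2 : ∑ s ∈ I, Real.log (1 + r / |(s : ℝ)|) ≤
        ∑ s ∈ I, ((d s - 1 - Real.log (d s)) + ε / 2 * r / (I.card + 1)) := by
      refine Finset.sum_le_sum fun s _ => ?_
      have h3 := hlin (d s) (r / |(s : ℝ)|) (hd0 s) (div_nonneg hr (hb s).le)
      have h4 : d s * (r / |(s : ℝ)|) = ε / 2 * r / (I.card + 1) := by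
        rw [hd]; have := (hb s).ne'; field_simp
      linarith
    refine h2.trans ?_
    rw [Finset.sum_add_distrib, Finset.sum_const, nsmul_eq_mul]
    have h5 : (I.card : ℝ) * (ε / 2 * r / (I.card + 1)) ≤ ε / 2 * r := by
      rw [mul_div_assoc', div_le_iff₀ (by positivity)]
      have : 0 ≤ ε / 2 * r := by positivity
      nlinarith
    linarith
  have htail : ∑' s : {s // s ∉ I}, Real.log (1 + r / |((s : S) : ℝ)|) ≤ ε / 2 * r := by
    have h6 : Summable fun s : {s // s ∉ I} => r * (1 / |((s : S) : ℝ)|) :=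
      (hS.mul_left r).comp_injective Subtype.val_injective
    have h7 : Summable fun s : {s // s ∉ I} => Real.log (1 + r / |((s : S) : ℝ)|) :=
      hlog.comp_injective Subtype.val_injective
    calc ∑' s : {s // s ∉ I}, Real.log (1 + r / |((s : S) : ℝ)|)
        ≤ ∑' s : {s // s ∉ I}, r * (1 / |((s : S) : ℝ)|) := by
          refine h7.tsum_le_tsum (fun s => ?_) h6
          have : 0 ≤ r / |((s : S) : ℝ)| := div_nonneg hr (hb s).le
          have := Real.log_le_sub_one_of_pos (by linarith : 0 < 1 + r / |((s : S) : ℝ)|)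
          rw [mul_one_div]; linarith
      _ = r * ∑' s : {s // s ∉ I}, 1 / |((s : S) : ℝ)| := tsum_mul_left
      _ ≤ r * (ε / 2) := mul_le_mul_of_nonneg_left hI.le hr
      _ = ε / 2 * r := mul_comm _ _
  linarith

theorem isEntireTypeZero_of_norm_le (h0 : (0 : ℝ) ∉ S) (hS : Summable fun s : S => 1 / |(s : ℝ)|)
    {f : ℂ → ℂ} (hf : Differentiable ℂ f) {c : ℝ} (hc : 0 ≤ c)
    (h : ∀ z, ‖f z‖ ≤ c * Real.exp (∑' s : S, Real.log (1 + ‖z‖ / |(s : ℝ)|))) :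
    IsEntireTypeZero f := by
  refine ⟨hf, fun ε hε => ?_⟩
  obtain ⟨C, hC⟩ := exists_tsum_log_le h0 hS hε
  refine ⟨c * Real.exp C, fun z => (h z).trans ?_⟩
  rw [mul_assoc, ← Real.exp_add]
  exact mul_le_mul_of_nonneg_left (Real.exp_le_exp.2 (hC _ (norm_nonneg z))) hc

theorem isEntireTypeZero_couplingW (h0 : (0 : ℝ) ∉ S)
    (hS : Summable fun s : S => 1 / |(s : ℝ)|) : IsEntireTypeZero (couplingW S) :=
  isEntireTypeZero_of_norm_le h0 hS (differentiable_couplingW hS) zero_le_one fun z => by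
    rw [one_mul]; exact norm_couplingW_le h0 hS z

theorem finite_abs_le (h0 : (0 : ℝ) ∉ S) (hS : Summable fun s : S => 1 / |(s : ℝ)|) {R : ℝ}
    (hR : 0 < R) : (S ∩ {s | |s| ≤ R}).Finite := by
  have h1 := (tendsto_order.1 hS.tendsto_cofinite_zero).2 (1 / R) (by positivity)
  rw [Filter.eventually_cofinite] at h1
  refine (h1.image Subtype.val).subset ?_
  rintro s ⟨hs, hsR⟩
  refine ⟨⟨s, hs⟩, ?_, rfl⟩
  simp only [Set.mem_ofPred_eq, not_lt] at hsR ⊢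
  exact one_div_le_one_div_of_le (abs_pos_of_zero_notMem h0 ⟨s, hs⟩) hsR

/-- The finitely many zeros in the closed disc are treated factor by factor; the remaining product
is zero-free there, so its average is `log 1 = 0`. -/
theorem circleAverage_log_norm_couplingW_le (h0 : (0 : ℝ) ∉ S)
    (hS : Summable fun s : S => 1 / |(s : ℝ)|) {R : ℝ} (hR : 0 < R) :
    Real.circleAverage (fun z => Real.log ‖couplingW S z‖) 0 R ≤
      ∑' s : S, Real.posLog (R / |(s : ℝ)|) := by
  have hfin := finite_abs_le h0 hS hR
  set A := S ∩ {s | |s| ≤ R} with hA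
  set B := S \ {s | |s| ≤ R} with hB
  have hAS : A ⊆ S := Set.inter_subset_left
  have hBS : B ⊆ S := Set.sdiff_subset
  have hsA := hS.one_div_abs_mono hAS
  have hsB := hS.one_div_abs_mono hBS
  have hAB : S = A ∪ B := (Set.inter_union_sdiff S _).symm
  have hd : Disjoint A B := Set.disjoint_left.2 fun s h1 h2 => h2.2 h1.2
  have hsplit : ∀ z, couplingW S z = couplingW A z * couplingW B z := fun z => by
    conv_lhs => rw [hAB]
    exact couplingW_union hd hsA hsB z
  simp only [hsplit]
  rw [circleAverage_log_norm_mul (differentiable_couplingW hsA) (differentiable_couplingW hsB)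
    (x := 0) (y := 0) (by simp [couplingW_zero]) (by simp [couplingW_zero]) hR.ne']
  have hBavg : Real.circleAverage (fun z => Real.log ‖couplingW B z‖) 0 R = 0 := by
    rw [AnalyticOnNhd.circleAverage_log_norm_of_ne_zero
      (fun z _ => (differentiable_couplingW hsB).analyticAt z)]
    · simp [couplingW_zero]
    · intro z hz
      refine couplingW_ne_zero (fun h => h0 (hBS h)) hsB fun s hs h => hs.2 ?_
      rw [mem_closedBall_zero_iff, h, Complex.norm_real, abs_of_pos hR] at hz
      exact hz
  have hpl := summable_posLog_div (abs_pos_of_zero_notMem h0) hS hR.le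
  have hAavg : Real.circleAverage (fun z => Real.log ‖couplingW A z‖) 0 R =
      ∑' s : A, Real.posLog (R / |(s : ℝ)|) := by
    have := hfin.fintype
    rw [tsum_fintype]
    have h1 : ∀ I : Finset A, Real.circleAverage
        (fun z => Real.log ‖∏ s ∈ I, (1 - z / ((s : ℝ) : ℂ))‖) 0 R =
          ∑ s ∈ I, Real.posLog (R / |(s : ℝ)|) := by
      intro I
      induction I using Finset.induction_on with
      | empty => simp [Real.circleAverage_const]
      | insert a I ha ih =>
        have ha0 : ((a : ℝ) : ℂ) ≠ 0 := by
          rw [Complex.ofReal_ne_zero]; exact fun h => h0 (h ▸ hAS a.2)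
        simp only [Finset.prod_insert ha, Finset.sum_insert ha]
        rw [circleAverage_log_norm_mul (f := fun z => 1 - z / ((a : ℝ) : ℂ)) (by fun_prop)
          (Differentiable.fun_finsetProd fun i _ => by fun_prop) (x := 0) (y := 0) (by simp)
          (by simp) hR.ne', circleAverage_log_norm_one_sub_div ha0 hR, ih, Complex.norm_real,
          Real.norm_eq_abs]
    rw [← h1 Finset.univ]
    simp only [couplingW, tprod_fintype]
  rw [hBavg, hAavg, add_zero]
  exact tsum_subtype_mono_of_nonneg (f := fun s => Real.posLog (R / |s|)) hpl hAS
    fun s => Real.posLog_nonneg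

end CanonicalProduct

/-! ### Herglotz quotients `z P / W`: zeros, Julia's inequality, residues. -/

section PositiveQuotient

open Metric Complex

theorem HasZeroMeanType.mul {f g : ℂ → ℂ} (hf : HasZeroMeanType f) (hg : HasZeroMeanType g)
    (hfd : Differentiable ℂ f) (hgd : Differentiable ℂ g) : HasZeroMeanType fun z => f z * g z := by
  intro ε hε
  filter_upwards [hf (ε / 2) (by positivity), hg (ε / 2) (by positivity)] with R h1 h2
  have i1 := circleIntegrable_posLog_norm hfd 0 R
  have i2 := circleIntegrable_posLog_norm hgd 0 R
  have h3 : Real.circleAverage (fun z => Real.posLog ‖f z * g z‖) 0 R ≤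
      Real.circleAverage (fun z => Real.posLog ‖f z‖ + Real.posLog ‖g z‖) 0 R :=
    Real.circleAverage_mono (circleIntegrable_posLog_norm (hfd.mul hgd) 0 R) (i1.add i2)
      fun z _ => by rw [norm_mul]; exact Real.posLog_mul
  rw [Real.circleAverage_fun_add i1 i2] at h3
  linarith

/-- The entire functions `P` of zero mean type for which `z P(z) / W(z)` is a Herglotz function. -/
structure IsPositiveNumerator (σ : Set ℝ) (P : ℂ → ℂ) : Prop where
  differentiable : Differentiable ℂ P
  hasZeroMeanType : HasZeroMeanType P
  map_zero : P 0 = 1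
  im_nonneg : ∀ z : ℂ, 0 < z.im → 0 ≤ (z * P z / couplingW σ z).im

namespace IsPositiveNumerator

variable {σ : Set ℝ} {P : ℂ → ℂ}

theorem differentiableAt_div (hS : Summable fun s : σ => 1 / |(s : ℝ)|)
    (hP : IsPositiveNumerator σ P) {z : ℂ} (hz : couplingW σ z ≠ 0) :
    DifferentiableAt ℂ (fun z => z * P z / couplingW σ z) z :=
  (differentiableAt_id.mul (hP.differentiable z)).div (differentiable_couplingW hS z) hz

theorem hasDerivAt_div (hS : Summable fun s : σ => 1 / |(s : ℝ)|)
    (hP : IsPositiveNumerator σ P) : HasDerivAt (fun z => z * P z / couplingW σ z) 1 0 := by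
  have h1 := ((hasDerivAt_id (0 : ℂ)).mul (hP.differentiable 0).hasDerivAt).div
    (differentiable_couplingW hS 0).hasDerivAt (by simp [couplingW_zero])
  refine h1.congr_deriv ?_
  simp [couplingW_zero, hP.map_zero]

/-- At a zero of `P` in the upper half-plane, `exp (i F)` with `F = z P / W` would attain its
maximal modulus `1` and hence be constant there. This contradicts `F' 0 = 1`, seen along the
imaginary axis. -/
theorem im_nonpos_of_eq_zero (h0 : (0 : ℝ) ∉ σ) (hS : Summable fun s : σ => 1 / |(s : ℝ)|)
    (hP : IsPositiveNumerator σ P) {a : ℂ} (ha : P a = 0) : a.im ≤ 0 := by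
  by_contra! him
  set F : ℂ → ℂ := fun z => z * P z / couplingW σ z with hF
  set φ : ℂ → ℂ := fun z => Complex.exp (I * F z) with hφ
  have hd : DifferentiableOn ℂ φ {z | 0 < z.im} := fun z hz =>
    ((hP.differentiableAt_div hS (couplingW_ne_zero_of_im h0 hS (ne_of_gt hz))).const_mul
      I).cexp.differentiableWithinAt
  have hφa : φ a = 1 := by simp [hφ, hF, ha]
  have hmax : IsMaxOn (norm ∘ φ) {z | 0 < z.im} a := fun z hz => by
    have h1 := hP.im_nonneg z hz
    simp only [Function.comp_apply, Set.mem_ofPred_eq, hφa, norm_one]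
    rw [hφ, Complex.norm_exp]
    simpa [hF] using h1
  have heq := Complex.eqOn_of_isPreconnected_of_isMaxOn_norm
    (convex_halfSpace_im_gt 0).isPreconnected
    (isOpen_lt continuous_const Complex.continuous_im) hd him hmax
  have hF0 : F 0 = 0 := by simp [hF]
  have hder : HasDerivAt (fun t : ℝ => φ ((t : ℂ) * I)) (-1) 0 := by
    have h1 : HasDerivAt φ I 0 := by
      have := ((hP.hasDerivAt_div hS).const_mul I).cexp
      refine this.congr_deriv ?_
      simp
    have h2 : HasDerivAt (fun t : ℝ => (t : ℂ) * I) I 0 := by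
      simpa using (Complex.ofRealCLM.hasDerivAt (x := (0 : ℝ))).mul_const I
    have h3 : HasDerivAt φ I ((((0 : ℝ) : ℂ)) * I) := by simpa using h1
    exact (h3.comp (0 : ℝ) h2).congr_deriv Complex.I_mul_I
  have hconst : HasDerivWithinAt (fun t : ℝ => φ ((t : ℂ) * I)) 0 (Set.Ici 0) 0 := by
    refine (hasDerivWithinAt_const (0 : ℝ) (Set.Ici 0) (1 : ℂ)).congr (fun t ht => ?_) ?_
    · rcases eq_or_lt_of_le (show (0 : ℝ) ≤ t from ht) with rfl | h
      · simp [hφ, hF0]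
      · rw [heq (show 0 < ((t : ℂ) * I).im by simpa using h), Function.const_apply, hφa]
    · simp [hφ, hF0]
  have := (uniqueDiffWithinAt_Ici (0 : ℝ)).eq_deriv _ hder.hasDerivWithinAt hconst
  norm_num at this

theorem im_nonneg_ofReal (hS : Summable fun s : σ => 1 / |(s : ℝ)|)
    (hP : IsPositiveNumerator σ P) {x : ℝ} (hx : couplingW σ (x : ℂ) ≠ 0) :
    0 ≤ ((x : ℂ) * P x / couplingW σ x).im := by
  have h1 := (Complex.continuous_im.continuousAt.comp
    (hP.differentiableAt_div hS hx).continuousAt).tendsto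
  have h2 : Tendsto (fun t : ℝ => (x : ℂ) + t * I) (𝓝[>] 0) (𝓝 (x : ℂ)) := by
    have : Continuous fun t : ℝ => (x : ℂ) + t * I := by fun_prop
    have h3 := this.tendsto 0
    simp only [Complex.ofReal_zero, zero_mul, add_zero] at h3
    exact h3.mono_left nhdsWithin_le_nhds
  refine ge_of_tendsto (h1.comp h2) ?_
  filter_upwards [self_mem_nhdsWithin] with t ht
  exact hP.im_nonneg _ (by simpa using ht)

/-- For small `t > 0` the real number `W(t)` is positive, so positivity on the real line gives `Im
P(t) ≥ 0 = Im P(0)`; then take the right difference quotient. -/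
theorem im_deriv_nonneg (hS : Summable fun s : σ => 1 / |(s : ℝ)|)
    (hP : IsPositiveNumerator σ P) : 0 ≤ (deriv P 0).im := by
  have h1 : HasDerivAt (fun t : ℝ => P t) (deriv P 0) 0 :=
    HasDerivAt.comp_ofReal (by simpa using (hP.differentiable 0).hasDerivAt)
  have h2 : HasDerivAt (fun t : ℝ => (P t).im) (deriv P 0).im 0 := by
    exact (Complex.imCLM.hasFDerivAt.comp_hasDerivAt (0 : ℝ) h1)
  have h3 := h2.hasDerivWithinAt (s := Set.Ioi 0)
  rw [hasDerivWithinAt_iff_tendsto_slope' (by simp)] at h3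
  refine ge_of_tendsto h3 ?_
  have h4 : ∀ᶠ t : ℝ in 𝓝[>] 0, 0 < (couplingW σ (t : ℂ)).re := by
    have hc : Continuous fun t : ℝ => (couplingW σ (t : ℂ)).re :=
      Complex.continuous_re.comp ((differentiable_couplingW hS).continuous.comp
        Complex.continuous_ofReal)
    have := hc.tendsto 0
    simp only [Complex.ofReal_zero, couplingW_zero, Complex.one_re] at this
    exact (this.mono_left nhdsWithin_le_nhds).eventually_const_lt zero_lt_one
  filter_upwards [h4, self_mem_nhdsWithin] with t ht1 ht2
  have ht2' : 0 < t := ht2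
  rw [couplingW_ofReal hS, Complex.ofReal_re] at ht1
  have h5 := hP.im_nonneg_ofReal hS (x := t) (by
    rw [couplingW_ofReal hS]; exact_mod_cast ht1.ne')
  rw [couplingW_ofReal hS, Complex.div_ofReal_im, Complex.im_ofReal_mul] at h5
  rw [slope_def_field]
  simp only [Complex.ofReal_zero, hP.map_zero, Complex.one_im, sub_zero]
  have h6 := mul_nonneg h5 ht1.le
  rw [div_mul_cancel₀ _ ht1.ne'] at h6
  exact div_nonneg (nonneg_of_mul_nonneg_right h6 ht2') ht2'.le

theorem im_eq_zero_of_eq_zero (h0 : (0 : ℝ) ∉ σ) (hS : Summable fun s : σ => 1 / |(s : ℝ)|)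
    (hP : IsPositiveNumerator σ P) {a : ℂ} (ha : P a = 0) : a.im = 0 :=
  hP.hasZeroMeanType.im_eq_zero hP.differentiable hP.map_zero
    (fun _ => hP.im_nonpos_of_eq_zero h0 hS) (hP.im_deriv_nonneg hS) ha

theorem map_conj (h0 : (0 : ℝ) ∉ σ) (hS : Summable fun s : σ => 1 / |(s : ℝ)|)
    (hP : IsPositiveNumerator σ P) (z : ℂ) :
    P ((starRingEnd ℂ) z) = (starRingEnd ℂ) (P z) :=
  hP.hasZeroMeanType.map_conj hP.differentiable hP.map_zero
    (fun _ => hP.im_eq_zero_of_eq_zero h0 hS) z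

/-- Julia's inequality in the upper half-plane. -/
theorem norm_mul_im_le_of_pos (h0 : (0 : ℝ) ∉ σ) (hS : Summable fun s : σ => 1 / |(s : ℝ)|)
    (hP : IsPositiveNumerator σ P) {z : ℂ} (hz : 0 < z.im) :
    ‖P z‖ * z.im ≤ ‖couplingW σ z‖ * ‖z‖ := by
  have hW := differentiable_couplingW hS
  have hPd := hP.differentiable
  set D : ℂ → ℂ := dslope (fun z => P z - couplingW σ z) 0 with hD
  have hDd : Differentiable ℂ D := differentiableOn_univ.1
    ((Complex.differentiableOn_dslope univ_mem).2 (hPd.sub hW).differentiableOn)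
  have hPne : ∀ w : ℂ, 0 < w.im → P w ≠ 0 := fun w hw h =>
    absurd (hP.im_nonpos_of_eq_zero h0 hS h) (not_le.2 hw)
  -- `h` is `1 / w - W / (w P)` with the singularity at the origin removed, which is possible since
  -- `P 0 = W 0 = 1`. The claim amounts to `Im h ≥ 0` in the upper half-plane.
  set h : ℂ → ℂ := fun w => D w / P w with hh
  have hform : ∀ w : ℂ, 0 < w.im → h w = 1 / w - couplingW σ w / (w * P w) := by
    intro w hw
    have hw0 : w ≠ 0 := by rintro rfl; simp at hw
    have h1 := hPne w hw
    simp only [hh, hD]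
    rw [dslope_of_ne _ hw0, slope_def_field, hP.map_zero, couplingW_zero]
    field_simp
    ring
  have hq : ∀ w : ℂ, 0 < w.im → -(h w).im ≤ w.im / ‖w‖ ^ 2 := by
    intro w hw
    have h1 : 0 ≤ (-(couplingW σ w / (w * P w))).im := by
      rw [← inv_div (w * P w), neg_im, inv_im, neg_div, neg_neg]
      exact div_nonneg (hP.im_nonneg w hw) (normSq_nonneg _)
    have h2 : (1 / w).im = -(w.im / ‖w‖ ^ 2) := by
      rw [one_div, inv_im, neg_div, normSq_eq_norm_sq]
    rw [hform w hw, sub_im, h2]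
    rw [neg_im] at h1
    linarith
  have hD0 : 0 ≤ (D 0).im := by
    have h1 : D 0 = deriv P 0 - deriv (couplingW σ) 0 := by
      rw [hD, dslope_same, deriv_fun_sub (hPd 0) (hW 0)]
    have h2 : (deriv (couplingW σ) 0).im = 0 := by
      have h3 := (hW 0).hasDerivAt
      have h4 : HasDerivAt (fun t : ℝ => couplingW σ (t : ℂ)) (deriv (couplingW σ) 0) 0 :=
        HasDerivAt.comp_ofReal (by simpa using h3)
      have h5 : HasDerivAt (fun t : ℝ => (couplingW σ (t : ℂ)).im)
        (deriv (couplingW σ) 0).im 0 := Complex.imCLM.hasFDerivAt.comp_hasDerivAt (0 : ℝ) h4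
      have h6 : (fun t : ℝ => (couplingW σ (t : ℂ)).im) = fun _ => (0 : ℝ) := by
        funext t; rw [couplingW_ofReal hS, Complex.ofReal_im]
      rw [h6] at h5
      exact h5.unique (hasDerivAt_const _ _)
    rw [h1, sub_im, h2, sub_zero]
    exact hP.im_deriv_nonneg hS
  have hcont : ContinuousAt (fun w => -(h w).im) 0 :=
    (Complex.continuous_im.continuousAt.comp
      (hDd.continuous.continuousAt.div hPd.continuous.continuousAt (by simp [hP.map_zero]))).neg
  have hh0 : -(h 0).im ≤ 0 := by simpa [hh, hP.map_zero] using hD0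
  have key : ∀ η : ℝ, 0 < η → -(h z).im ≤ 0 + η := by
    intro η hη
    have h1 : ∀ᶠ w in 𝓝 (0 : ℂ), -(h w).im < η :=
      hcont.tendsto.eventually_lt_const (hh0.trans_lt hη)
    obtain ⟨ρ, hρ, hρη⟩ := Metric.eventually_nhds_iff.1 h1
    -- Phragmén–Lindelöf is applied above the line `Im u = ε`, which must pass below `z`. On that
    -- line `ε < η ρ²` gives `-Im h ≤ ε / ‖u‖² ≤ η` when `‖u‖ ≥ ρ`; nearer to the origin continuity
    -- of `h` gives it.
    obtain ⟨ε, hε, hεlt⟩ := exists_between (lt_min hz (show 0 < η * ρ ^ 2 by positivity))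
    have hε1 := hεlt.trans_le (min_le_left _ _)
    have hε2 := hεlt.trans_le (min_le_right _ _)
    set ψ : ℂ → ℂ := fun w => Complex.exp (I * h (I * (w + ε))) with hψ
    have hnorm : ∀ w, ‖ψ w‖ = Real.exp (-(h (I * (w + ε))).im) := fun w => by
      rw [hψ, Complex.norm_exp]; simp
    have him : ∀ w : ℂ, (I * (w + ε)).im = w.re + ε := fun w => by simp
    have hle : ∀ u : ℂ, ε ≤ u.im → -(h u).im ≤ 1 / ε := by
      intro u hu
      have hu0 : 0 < u.im := hε.trans_le hu
      have h2 : u.im ≤ ‖u‖ := (le_abs_self _).trans (Complex.abs_im_le_norm u)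
      refine (hq u hu0).trans ?_
      rw [div_le_div_iff₀ (by nlinarith) hε]
      nlinarith
    have hdc : DiffContOnCl ℂ ψ {w | 0 < w.re} := by
      have h2 : ∀ w : ℂ, 0 ≤ w.re → DifferentiableAt ℂ ψ w := by
        intro w hw
        have h3 : P (I * (w + ε)) ≠ 0 := hPne _ (by rw [him]; linarith)
        have h4 : DifferentiableAt ℂ (fun w : ℂ => I * (w + ε)) w := by fun_prop
        have h5 : DifferentiableAt ℂ h (I * (w + ε)) :=
          (hDd _).div (hPd _) h3
        exact ((h5.comp w h4).const_mul I).cexp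
      refine ⟨fun w hw => (h2 w (le_of_lt hw)).differentiableWithinAt, fun w hw => ?_⟩
      refine (h2 w ?_).continuousAt.continuousWithinAt
      exact closure_minimal (fun u hu => le_of_lt hu)
        (isClosed_le continuous_const Complex.continuous_re) hw
    have hbd : ∀ w : ℂ, 0 ≤ w.re → ‖ψ w‖ ≤ Real.exp (1 / ε) := fun w hw => by
      rw [hnorm]
      exact Real.exp_le_exp.2 (hle _ (by rw [him]; linarith))
    have hfin := PhragmenLindelof.right_half_plane_of_bounded_on_real (C := Real.exp η)
      (z := z / I - ε) hdc ⟨0, by norm_num, 0, ?_⟩ ?_ ?_ ?_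
    · rw [hnorm] at hfin
      have h2 : I * (z / I - ε + ε) = z := by
        rw [sub_add_cancel, mul_div_cancel₀ _ I_ne_zero]
      rw [h2] at hfin
      simpa using Real.exp_le_exp.1 hfin
    · refine Asymptotics.IsBigO.of_bound (Real.exp (1 / ε)) ?_
      filter_upwards [mem_inf_of_right (mem_principal_self _)] with w hw
      simpa using hbd w (le_of_lt hw)
    · exact isBoundedUnder_of_eventually_le (a := Real.exp (1 / ε))
        ((eventually_ge_atTop 0).mono fun x hx => hbd x (by simpa using hx))
    · intro x
      rw [hnorm]
      refine Real.exp_le_exp.2 ?_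
      set u : ℂ := I * (x * I + ε) with hu
      have hui : u.im = ε := by rw [hu, him]; simp
      rcases lt_or_ge ‖u‖ ρ with h3 | h3
      · exact (hρη (by simpa using h3)).le
      · refine (hq u (by rw [hui]; exact hε)).trans ?_
        have hu0 : 0 < ‖u‖ := hρ.trans_le h3
        rw [hui, div_le_iff₀ (by positivity)]
        have : ρ ^ 2 ≤ ‖u‖ ^ 2 := by gcongr
        nlinarith
    · simp [Complex.div_I]; linarith
  have hfin : -(h z).im ≤ 0 := le_of_forall_pos_le_add key
  have hz0 : z ≠ 0 := by rintro rfl; simp at hz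
  have hzn : 0 < ‖z‖ := norm_pos_iff.2 hz0
  have hPn : 0 < ‖P z‖ := norm_pos_iff.2 (hPne z hz)
  have h1 : z.im / ‖z‖ ^ 2 ≤ ‖couplingW σ z / (z * P z)‖ := by
    rw [hform z hz, sub_im, one_div, inv_im, neg_div, normSq_eq_norm_sq] at hfin
    have := Complex.abs_im_le_norm (couplingW σ z / (z * P z))
    have := neg_abs_le (couplingW σ z / (z * P z)).im
    linarith
  rw [norm_div, norm_mul, div_le_div_iff₀ (by positivity) (by positivity)] at h1
  have h2 : (‖P z‖ * z.im) * ‖z‖ ≤ (‖couplingW σ z‖ * ‖z‖) * ‖z‖ := by nlinarith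
  exact le_of_mul_le_mul_right h2 hzn

theorem norm_mul_abs_im_le (h0 : (0 : ℝ) ∉ σ) (hS : Summable fun s : σ => 1 / |(s : ℝ)|)
    (hP : IsPositiveNumerator σ P) (z : ℂ) :
    ‖P z‖ * |z.im| ≤ ‖couplingW σ z‖ * ‖z‖ := by
  rcases lt_trichotomy z.im 0 with hz | hz | hz
  · have h1 := hP.norm_mul_im_le_of_pos h0 hS (z := (starRingEnd ℂ) z) (by simpa using hz)
    rw [hP.map_conj h0 hS, couplingW_conj hS] at h1
    simp only [Complex.norm_conj, Complex.conj_im] at h1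
    rwa [abs_of_neg hz]
  · rw [hz, abs_zero, mul_zero]; positivity
  · rw [abs_of_pos hz]; exact hP.norm_mul_im_le_of_pos h0 hS hz

/-- Julia's inequality reads `|P (1 - z²/R²)| ≤ 2 |W|` on the circle of radius `R`. The extra factor
has its roots on that circle, so its logarithmic average vanishes. -/
theorem circleAverage_log_norm_le (h0 : (0 : ℝ) ∉ σ) (hS : Summable fun s : σ => 1 / |(s : ℝ)|)
    (hP : IsPositiveNumerator σ P) {R : ℝ} (hR : 0 < R) :
    Real.circleAverage (fun z => Real.log ‖P z‖) 0 R ≤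
      Real.log 2 + ∑' s : σ, Real.posLog (R / |(s : ℝ)|) := by
  have hW := differentiable_couplingW hS
  have hR0 : (R : ℂ) ≠ 0 := by exact_mod_cast hR.ne'
  have h1 : Real.circleAverage (fun z => Real.log ‖P z * rootPoly {(R : ℂ), -(R : ℂ)} z‖) 0 R ≤
      Real.circleAverage (fun z => Real.log ‖(2 : ℂ) * couplingW σ z‖) 0 R := by
    refine _root_.circleAverage_log_norm_le (hP.differentiable.mul (differentiable_rootPoly _))
      (hW.const_mul 2) (x := 0) (by simp [hP.map_zero, rootPoly_zero]) hR.ne' fun z hz => ?_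
    have hz' : ‖z‖ = R := by simpa [abs_of_pos hR] using hz
    have h5 := hP.norm_mul_abs_im_le h0 hS z
    rw [hz'] at h5
    rw [Pi.mul_apply, norm_mul, norm_mul, norm_rootPoly_pair hR hz', Complex.norm_ofNat,
      mul_div_assoc', div_le_iff₀ hR]
    linarith
  rw [circleAverage_log_norm_mul hP.differentiable (differentiable_rootPoly _) (x := 0) (y := 0)
    (by simp [hP.map_zero]) (by simp [rootPoly_zero]) hR.ne',
    circleAverage_log_norm_rootPoly (by simp [hR0]) hR,
    circleAverage_log_norm_mul (differentiable_const (2 : ℂ)) hW (x := 0) (y := 0)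
    two_ne_zero (by simp [couplingW_zero]) hR.ne', Real.circleAverage_const,
    Complex.norm_ofNat] at h1
  have h2 : (Multiset.map (fun μ : ℂ => Real.posLog (R / ‖μ‖)) {(R : ℂ), -(R : ℂ)}).sum = 0 := by
    simp [abs_of_pos hR, div_self hR.ne']
  have h3 := circleAverage_log_norm_couplingW_le h0 hS hR
  linarith

/-- The residues of a Herglotz function are negative. -/
theorem residue_nonneg (h0 : (0 : ℝ) ∉ σ) (hS : Summable fun s : σ => 1 / |(s : ℝ)|)
    (hP : IsPositiveNumerator σ P) {l : ℝ} (hl : l ∈ σ) :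
    ∃ γ : ℝ, 0 ≤ γ ∧ P l = γ * couplingW (σ \ {l}) l := by
  have hsub : σ \ {l} ⊆ σ := Set.sdiff_subset
  have hS' := hS.one_div_abs_mono hsub
  have h0' : (0 : ℝ) ∉ σ \ {l} := fun h => h0 (hsub h)
  have hSl : Summable fun s : ({l} : Set ℝ) => 1 / |(s : ℝ)| :=
    hS.one_div_abs_mono (Set.singleton_subset_iff.2 hl)
  have hl0 : l ≠ 0 := fun h => h0 (h ▸ hl)
  have hlC : (l : ℂ) ≠ 0 := by exact_mod_cast hl0
  set W₁ := couplingW (σ \ {l}) with hW₁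
  have hW₁l : W₁ l ≠ 0 := couplingW_ne_zero h0' hS' fun s hs h => hs.2 (by exact_mod_cast h.symm)
  have hsplit : ∀ z, couplingW σ z = W₁ z * (1 - z / l) := fun z => by
    rw [← couplingW_singleton, ← couplingW_union Set.disjoint_sdiff_left hS' hSl,
      Set.sdiff_union_of_subset (Set.singleton_subset_iff.2 hl)]
  have hreal : ∃ γ : ℝ, P l / W₁ l = γ := by
    rw [← Complex.conj_eq_iff_real, map_div₀, ← hP.map_conj h0 hS, ← couplingW_conj hS',
      Complex.conj_ofReal]
  obtain ⟨γ, hγ⟩ := hreal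
  refine ⟨γ, ?_, by rw [← hγ, div_mul_cancel₀ _ hW₁l]⟩
  -- Approaching `l` vertically, `1 / (1 - z / l) = (l / t) I`. Thus `t` times the imaginary part of
  -- the Herglotz function tends to `l² γ`.
  have hlim : Tendsto (fun t : ℝ => l * (((l : ℂ) + t * I) * P (l + t * I) /
      W₁ (l + t * I)).re) (𝓝[>] 0) (𝓝 (l * (((l : ℂ) * P l / W₁ l).re))) := by
    have h1 : ContinuousAt (fun z : ℂ => l * (z * P z / W₁ z).re) l := by
      refine continuousAt_const.mul (Complex.continuous_re.continuousAt.comp ?_)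
      exact (continuousAt_id.mul hP.differentiable.continuous.continuousAt).div
        (differentiable_couplingW hS').continuous.continuousAt hW₁l
    have h2 : Tendsto (fun t : ℝ => (l : ℂ) + t * I) (𝓝[>] 0) (𝓝 (l : ℂ)) := by
      have : Continuous fun t : ℝ => (l : ℂ) + t * I := by fun_prop
      have h3 := this.tendsto 0
      simp only [Complex.ofReal_zero, zero_mul, add_zero] at h3
      exact h3.mono_left nhdsWithin_le_nhds
    exact h1.tendsto.comp h2
  have h3 : 0 ≤ l * (((l : ℂ) * P l / W₁ l).re) := by
    refine ge_of_tendsto hlim ?_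
    filter_upwards [self_mem_nhdsWithin] with t ht
    have ht0 : 0 < t := ht
    have htC : (t : ℂ) ≠ 0 := by exact_mod_cast ht0.ne'
    have h4 := hP.im_nonneg (l + t * I) (by simpa using ht0)
    have h5 : ∀ A : ℂ, A / (W₁ (l + t * I) * (1 - (l + t * I) / l)) =
        ((l / t : ℝ) : ℂ) * (I * (A / W₁ (l + t * I))) := by
      intro A
      have h6 : (1 : ℂ) - (l + t * I) / l = -(t * I) / l := by field_simp; ring
      have h7 : (-(t * I) / l : ℂ)⁻¹ = (l / t : ℂ) * I := by
        rw [inv_div, div_eq_iff (by simp [htC])]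
        field_simp
        rw [Complex.I_sq]; ring
      rw [h6, ← div_div, div_eq_mul_inv _ (-(t * I) / l : ℂ), h7]
      push_cast; ring
    rw [hsplit, h5, Complex.im_ofReal_mul, Complex.I_mul_im] at h4
    have h8 := mul_nonneg h4 ht0.le
    rwa [mul_right_comm, div_mul_cancel₀ _ ht0.ne'] at h8
  rw [mul_div_assoc, hγ, ← Complex.ofReal_mul, Complex.ofReal_re, ← mul_assoc] at h3
  exact nonneg_of_mul_nonneg_right h3 (mul_self_pos.2 hl0)

end IsPositiveNumerator

end PositiveQuotient

/-! ### Rigidity, division by `W`, and normal families. -/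

section Limits

open Metric Complex

theorem HasZeroMeanType.cofactor {f p k : ℂ → ℂ} (hf : HasZeroMeanType f) (hp : HasZeroMeanType p)
    (hfd : Differentiable ℂ f) (hpd : Differentiable ℂ p) (hkd : Differentiable ℂ k)
    (hp0 : p 0 = 1) (h : ∀ z, f z = p z * k z) : HasZeroMeanType k := by
  intro ε hε
  filter_upwards [hf (ε / 2) (by positivity), hp (ε / 2) (by positivity), eventually_gt_atTop 0]
    with R h1 h2 hR
  have h3 := circleAverage_posLog_cofactor_le hfd hpd hkd hp0 h hR
  have h4 := circleAverage_log_norm_nonneg hpd hp0 hR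
  linarith

/-- If both factors had zeros, these would coincide with the only zero of `1 + c z`, which would
then be a double zero although its derivative is `c ≠ 0`. -/
theorem eq_one_or_eq_one_of_mul_eq_linear {f g : ℂ → ℂ} (hf : Differentiable ℂ f)
    (hg : Differentiable ℂ g) (hfT : HasZeroMeanType f) (hgT : HasZeroMeanType g) (hf0 : f 0 = 1)
    (hg0 : g 0 = 1) {c : ℂ} (h : ∀ z, f z * g z = 1 + c * z) :
    (∀ z, f z = 1) ∨ ∀ z, g z = 1 := by
  by_cases h1 : ∀ z, f z ≠ 0
  · exact Or.inl (hfT.eq_one hf hf0 h1)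
  by_cases h2 : ∀ z, g z ≠ 0
  · exact Or.inr (hgT.eq_one hg hg0 h2)
  push Not at h1 h2
  obtain ⟨a, ha⟩ := h1
  obtain ⟨b, hb⟩ := h2
  exfalso
  have ha' := h a
  have hb' := h b
  rw [ha, zero_mul] at ha'
  rw [hb, mul_zero] at hb'
  have hc : c ≠ 0 := by rintro rfl; simp at ha'
  have hab : a = b := mul_left_cancel₀ hc (by linear_combination hb' - ha')
  subst hab
  have h3 := (hf a).hasDerivAt.fun_mul (hg a).hasDerivAt
  rw [ha, hb, mul_zero, zero_mul, add_zero] at h3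
  have h4 : HasDerivAt (fun z => f z * g z) c a := by
    rw [funext h]
    simpa using ((hasDerivAt_id a).const_mul c).const_add 1
  exact hc (h4.unique h3)

/-- Multiplication by `1 - u²/s²` absorbs `|Im u|` on the circle of radius `s`. The maximum
principle then yields linear growth, and Liouville applied to the difference quotient at `0`
finishes. -/
theorem exists_eq_add_mul_of_norm_mul_abs_im_le {h : ℂ → ℂ} (hd : Differentiable ℂ h) {A : ℝ}
    (hA : ∀ z, ‖h z‖ * |z.im| ≤ A * (1 + ‖z‖) ^ 2) : ∃ c : ℂ, ∀ z, h z = h 0 + c * z := by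
  have hA0 : 0 ≤ A := by
    have := hA 0; simpa using this
  have hlin : ∀ z, ‖h z‖ ≤ 11 * A * (2 * ‖z‖ + 1) := by
    intro z
    -- With `‖z / s‖ ≤ 1 / 2` the auxiliary factor is at least `3 / 4` at `z`, and `8 / (3 / 4) ≤
    -- 11`.
    set s := 2 * ‖z‖ + 1 with hs
    have hs1 : 1 ≤ s := by linarith [norm_nonneg z]
    have hs0 : 0 < s := by linarith
    have hfr : ∀ u ∈ frontier (ball (0 : ℂ) s),
        ‖h u * rootPoly {(s : ℂ), -(s : ℂ)} u‖ ≤ 8 * A * s := by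
      intro u hu
      rw [frontier_ball _ hs0.ne', mem_sphere_zero_iff_norm] at hu
      have h1 := hA u
      rw [norm_mul, norm_rootPoly_pair hs0 hu, mul_div_assoc', div_le_iff₀ hs0]
      rw [hu] at h1
      nlinarith [mul_nonneg hA0 (sub_nonneg.2 hs1), mul_nonneg hA0 hs0.le]
    have h2 := Complex.norm_le_of_forall_mem_frontier_norm_le isBounded_ball
      (hd.mul (differentiable_rootPoly {(s : ℂ), -(s : ℂ)})).diffContOnCl hfr
      (subset_closure (show z ∈ ball (0 : ℂ) s by rw [mem_ball_zero_iff]; linarith [norm_nonneg z]))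
    have h3 : 3 / 4 ≤ ‖rootPoly {(s : ℂ), -(s : ℂ)} z‖ := by
      have hsC : (s : ℂ) ≠ 0 := by exact_mod_cast hs0.ne'
      have h4 : rootPoly {(s : ℂ), -(s : ℂ)} z = 1 - (z / s) ^ 2 := by
        simp only [rootPoly, Multiset.insert_eq_cons, Multiset.map_cons, Multiset.map_singleton,
          Multiset.prod_cons, Multiset.prod_singleton]
        field_simp
        ring
      have h5 : ‖z / s‖ ≤ 1 / 2 := by
        rw [norm_div, Complex.norm_real, Real.norm_eq_abs, abs_of_pos hs0, div_le_iff₀ hs0]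
        linarith
      have h6 := norm_sub_norm_le (1 : ℂ) ((z / s) ^ 2)
      rw [norm_pow, norm_one] at h6
      rw [h4]
      nlinarith [norm_nonneg (z / s)]
    rw [Pi.mul_apply, norm_mul] at h2
    nlinarith [norm_nonneg (h z), mul_nonneg hA0 hs0.le]
  set g := dslope h 0 with hg
  have hgd : Differentiable ℂ g := differentiableOn_univ.1
    ((Complex.differentiableOn_dslope univ_mem).2 hd.differentiableOn)
  obtain ⟨C, hC⟩ := (isCompact_closedBall (0 : ℂ) 1).exists_bound_of_continuousOn
    hgd.continuous.continuousOn
  have hgb : Bornology.IsBounded (Set.range g) := by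
    refine (isBounded_iff_forall_norm_le).2 ⟨max C (44 * A), ?_⟩
    rintro _ ⟨z, rfl⟩
    rcases le_or_gt ‖z‖ 1 with hz | hz
    · exact (hC z (by simpa using hz)).trans (le_max_left _ _)
    · refine le_trans ?_ (le_max_right _ _)
      have hz0 : z ≠ 0 := by rintro rfl; norm_num at hz
      rw [hg, dslope_of_ne _ hz0, slope_def_field, sub_zero, norm_div, div_le_iff₀ (by linarith)]
      have h1 := hlin z
      have h2 := hlin 0
      rw [norm_zero] at h2
      have h3 := norm_sub_le (h z) (h 0)
      nlinarith
  refine ⟨g 0, fun z => ?_⟩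
  have h1 := sub_smul_dslope h 0 z
  rw [← hg, hgd.apply_eq_apply_of_bounded hgb z 0, smul_eq_mul, sub_zero] at h1
  linear_combination -h1

theorem exists_eq_couplingW_mul {S : Set ℝ} (h0 : (0 : ℝ) ∉ S)
    (hS : Summable fun s : S => 1 / |(s : ℝ)|) {f : ℂ → ℂ} (hf : Differentiable ℂ f)
    (hz : ∀ s ∈ S, f ((s : ℝ) : ℂ) = 0) :
    ∃ h : ℂ → ℂ, Differentiable ℂ h ∧ ∀ z, f z = couplingW S z * h z := by
  classical
  have hW := differentiable_couplingW hS
  -- The zeros of `W` are simple, so the quotient of derivatives is the value of the holomorphic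
  -- extension.
  set h : ℂ → ℂ := fun z => if couplingW S z = 0 then deriv f z / deriv (couplingW S) z
    else f z / couplingW S z with hh
  refine ⟨h, fun z => ?_, fun z => ?_⟩
  · by_cases hWz : couplingW S z = 0
    · obtain ⟨s, hs, rfl⟩ := (couplingW_eq_zero_iff h0 hS).1 hWz
      have hs0 : (s : ℂ) ≠ 0 := by
        rw [Complex.ofReal_ne_zero]; rintro rfl; exact h0 hs
      have hsub : S \ {s} ⊆ S := Set.sdiff_subset
      have hS' := hS.one_div_abs_mono hsub
      have hSl : Summable fun t : ({s} : Set ℝ) => 1 / |(t : ℝ)| :=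
        hS.one_div_abs_mono (Set.singleton_subset_iff.2 hs)
      set W₁ := couplingW (S \ {s}) with hW₁
      have hW₁d : Differentiable ℂ W₁ := differentiable_couplingW hS'
      have hW₁s : W₁ s ≠ 0 := couplingW_ne_zero (fun h => h0 (hsub h)) hS'
        fun t ht h => ht.2 (by exact_mod_cast h.symm)
      have hsplit : ∀ z, couplingW S z = (1 - z / s) * W₁ z := fun z => by
        rw [← couplingW_singleton, mul_comm, ← couplingW_union Set.disjoint_sdiff_left hS' hSl,
          Set.sdiff_union_of_subset (Set.singleton_subset_iff.2 hs)]
      obtain ⟨g, hg, hfg⟩ := exists_eq_one_sub_div_mul hf hs0 (hz s hs)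
      have hder : ∀ {k F : ℂ → ℂ}, Differentiable ℂ k → (∀ z, F z = (1 - z / s) * k z) →
          deriv F s = -(s : ℂ)⁻¹ * k s := by
        intro k F hk hF
        have h1 : HasDerivAt (fun z : ℂ => 1 - z / s) (-(s : ℂ)⁻¹) s := by
          simpa [neg_div] using ((hasDerivAt_id (s : ℂ)).div_const (s : ℂ)).const_sub 1
        have h2 := h1.fun_mul (hk s).hasDerivAt
        rw [div_self hs0, sub_self, zero_mul, add_zero] at h2
        rw [funext hF]; exact h2.deriv
      have heq : h =ᶠ[𝓝 (s : ℂ)] fun z => g z / W₁ z := by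
        filter_upwards [hW₁d.continuous.continuousAt.eventually_ne hW₁s] with z hzW
        by_cases hzs : z = s
        · subst hzs
          have hc : -(s : ℂ)⁻¹ ≠ 0 := neg_ne_zero.2 (inv_ne_zero hs0)
          simp only [hh, if_pos hWz]
          rw [hder hg hfg, hder hW₁d hsplit, mul_div_mul_left _ _ hc]
        · have h1 : (1 : ℂ) - z / s ≠ 0 := by
            rw [sub_ne_zero]; intro h; exact hzs ((div_eq_one_iff_eq hs0).1 h.symm)
          simp only [hh]
          rw [hsplit, if_neg (mul_ne_zero h1 hzW), hfg, mul_div_mul_left _ _ h1]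
      exact ((hg _).div (hW₁d _) hW₁s).congr_of_eventuallyEq heq
    · have heq : h =ᶠ[𝓝 z] fun z => f z / couplingW S z := by
        filter_upwards [hW.continuous.continuousAt.eventually_ne hWz] with w hw
        simp only [hh, if_neg hw]
      exact ((hf z).div (hW z) hWz).congr_of_eventuallyEq heq
  · by_cases hWz : couplingW S z = 0
    · obtain ⟨s, hs, rfl⟩ := (couplingW_eq_zero_iff h0 hS).1 hWz
      rw [hWz, hz s hs, zero_mul]
    · simp only [hh, if_neg hWz]; rw [mul_div_cancel₀ _ hWz]

theorem norm_sub_le_of_norm_le_on_ball {f : ℂ → ℂ} (hf : Differentiable ℂ f) {a : ℂ} {C : ℝ}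
    (hC : ∀ z ∈ ball a 2, ‖f z‖ ≤ C) {z : ℂ} (hz : z ∈ ball a 1) : ‖f z - f a‖ ≤ C * ‖z - a‖ := by
  refine (convex_ball a 1).norm_image_sub_le_of_norm_deriv_le (fun w _ => hf w) (fun w hw => ?_)
    (mem_ball_self one_pos) hz
  have h1 : ∀ r ∈ Set.Ioo (0 : ℝ) 1, ‖deriv f w‖ ≤ C / r := fun r hr =>
    Complex.norm_deriv_le_of_forall_mem_sphere_norm_le hr.1 hf.diffContOnCl fun u hu => hC u (by
      rw [mem_ball] at hw ⊢
      rw [mem_sphere] at hu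
      linarith [dist_triangle u w a, hr.2])
  have h2 : Tendsto (fun r : ℝ => C / r) (𝓝[<] 1) (𝓝 (C / 1)) :=
    ((continuousAt_const.div continuousAt_id one_ne_zero).tendsto).mono_left nhdsWithin_le_nhds
  rw [div_one] at h2
  exact ge_of_tendsto h2 (by
    filter_upwards [Ioo_mem_nhdsLT one_pos] with r hr using h1 r hr)

/-- Montel's theorem along an ultrafilter. -/
theorem exists_tendstoLocallyUniformly_ultrafilter {Δ : Type*} (U : Ultrafilter Δ) {D : Set Δ}
    (hD : D ∈ U) {Φ : ℂ → Δ → ℂ} {B : ℝ → ℝ} (hB : Monotone B)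
    (hd : ∀ δ ∈ D, Differentiable ℂ fun z => Φ z δ) (hb : ∀ δ ∈ D, ∀ z, ‖Φ z δ‖ ≤ B ‖z‖) :
    ∃ f : ℂ → ℂ, Differentiable ℂ f ∧ (∀ z, Tendsto (Φ z) U (𝓝 (f z))) ∧
      TendstoLocallyUniformly (fun δ z => Φ z δ) f (U : Filter Δ) := by
  have hlim : ∀ z, ∃ w, Tendsto (Φ z) U (𝓝 w) := by
    intro z
    have h1 : closedBall (0 : ℂ) (B ‖z‖) ∈ U.map (Φ z) := by
      rw [Ultrafilter.mem_map]
      exact mem_of_superset hD fun δ hδ => by simpa using hb δ hδ z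
    obtain ⟨w, -, hw⟩ := (isCompact_closedBall (0 : ℂ) (B ‖z‖)).ultrafilter_le_nhds
      (U.map (Φ z)) (le_principal_iff.2 h1)
    exact ⟨w, hw⟩
  choose f hf using hlim
  have hlu : TendstoLocallyUniformly (fun δ z => Φ z δ) f (U : Filter Δ) := by
    rw [Metric.tendstoLocallyUniformly_iff]
    intro ε hε a
    set C := max (B (‖a‖ + 2)) 0 with hC
    have hC0 : 0 ≤ C := le_max_right _ _
    -- Cauchy's estimate gives a Lipschitz constant independent of `δ`, which upgrades the pointwise
    -- ultrafilter limit to a locally uniform one.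
    have hLip : ∀ δ ∈ D, ∀ z ∈ ball a 1, ‖Φ z δ - Φ a δ‖ ≤ C * ‖z - a‖ := fun δ hδ z hz =>
      norm_sub_le_of_norm_le_on_ball (f := fun z => Φ z δ) (hd δ hδ) (fun w hw => by
        refine (hb δ hδ w).trans ((hB ?_).trans (le_max_left _ _))
        rw [mem_ball_iff_norm] at hw
        have := norm_add_le (w - a) a
        rw [sub_add_cancel] at this
        linarith) hz
    have hLipf : ∀ z ∈ ball a 1, ‖f z - f a‖ ≤ C * ‖z - a‖ := fun z hz =>
      le_of_tendsto ((hf z).sub (hf a)).norm (by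
        filter_upwards [hD] with δ hδ using hLip δ hδ z hz)
    have hr : 0 < min 1 (ε / (3 * (C + 1))) := lt_min one_pos (by positivity)
    refine ⟨ball a (min 1 (ε / (3 * (C + 1)))), ball_mem_nhds a hr, ?_⟩
    filter_upwards [hD, (Metric.tendsto_nhds.1 (hf a)) (ε / 3) (by positivity)] with δ hδ h1 z hz
    have hz1 : z ∈ ball a 1 := ball_subset_ball (min_le_left _ _) hz
    have hz2 : C * ‖z - a‖ < ε / 3 := by
      have h2 : ‖z - a‖ < ε / (3 * (C + 1)) :=
        (mem_ball_iff_norm.1 hz).trans_le (min_le_right _ _)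
      rw [lt_div_iff₀ (by positivity)] at h2
      nlinarith [norm_nonneg (z - a)]
    have h3 := hLip δ hδ z hz1
    have h4 := hLipf z hz1
    rw [dist_eq_norm] at h1
    rw [dist_eq_norm]
    have h5 : f z - Φ z δ = (f z - f a) - (Φ z δ - Φ a δ) - (Φ a δ - f a) := by ring
    rw [h5]
    have h6 := norm_sub_le ((f z - f a) - (Φ z δ - Φ a δ)) (Φ a δ - f a)
    have h7 := norm_sub_le (f z - f a) (Φ z δ - Φ a δ)
    linarith
  refine ⟨f, ?_, hf, hlu⟩
  rw [← differentiableOn_univ]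
  refine (tendstoLocallyUniformlyOn_univ.2 hlu).differentiableOn ?_ isOpen_univ
  filter_upwards [hD] with δ hδ using (hd δ hδ).differentiableOn

end Limits

/-! ### Coupling constants and their limits. -/

section CouplingConstants

open Metric Complex

namespace CouplingConst

theorem eq_top_or_coe (η : CouplingConst) : η = ⊤ ∨ ∃ x : ℝ, η = (x : WithTop ℝ) := by
  rcases η with _ | x
  · exact Or.inl rfl
  · exact Or.inr ⟨x, rfl⟩

theorem minRecip_top : minRecip ⊤ = 0 := by
  have h := coe_minRecip ⊤
  rw [recip_top, min_eq_left le_top] at h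
  exact_mod_cast h

/-- The right-hand side is continuous on `[0, ∞)` including `y = 0`, so limits can be taken without
separating cases. -/
theorem minRecip_coe_of_nonneg {y : ℝ} (hy : 0 ≤ y) :
    minRecip (y : WithTop ℝ) = min y (max y 1)⁻¹ := by
  have h := coe_minRecip (y : WithTop ℝ)
  rcases eq_or_lt_of_le hy with rfl | hy
  · rw [recip_zero, min_eq_right le_top] at h
    rw [WithTop.coe_inj.1 h]; norm_num
  · rw [recip_coe hy.ne', ← WithTop.coe_min] at h
    rw [WithTop.coe_inj.1 h]
    rcases le_total y 1 with h1 | h1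
    · rw [max_eq_right h1, inv_one, min_eq_left h1, min_eq_right (h1.trans (one_le_inv₀ hy |>.2 h1))]
    · rw [max_eq_left h1, min_comm]

theorem minRecip_coe_inv {y : ℝ} (hy : y ≠ 0) :
    minRecip (y : WithTop ℝ) = minRecip ((y⁻¹ : ℝ) : WithTop ℝ) := by
  have h1 := coe_minRecip (y : WithTop ℝ)
  have h2 := coe_minRecip ((y⁻¹ : ℝ) : WithTop ℝ)
  rw [recip_coe hy] at h1
  rw [recip_coe (inv_ne_zero hy), inv_inv, min_comm] at h2
  exact WithTop.coe_inj.1 (h1.trans h2.symm)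

theorem mulReal_top (c : ℝ) : mulReal ⊤ c = ⊤ := rfl

theorem mulReal_coe (x c : ℝ) : mulReal (x : WithTop ℝ) c = ((x * c : ℝ) : WithTop ℝ) := rfl

theorem exp_lt_abs_of_negLogAbs_lt {x M : ℝ} (h : negLogAbs (x : WithTop ℝ) < ((-M : ℝ) : EReal)) :
    Real.exp M < |x| := by
  rcases eq_or_ne x 0 with rfl | hx
  · rw [negLogAbs_zero] at h; exact absurd h (not_lt.2 le_top)
  · rw [negLogAbs_coe hx, EReal.coe_lt_coe_iff] at h
    rw [← Real.lt_log_iff_exp_lt (abs_pos.2 hx)]; linarith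

theorem abs_lt_exp_of_lt_negLogAbs {x M : ℝ} (h : ((M : ℝ) : EReal) < negLogAbs (x : WithTop ℝ)) :
    |x| < Real.exp (-M) := by
  rcases eq_or_ne x 0 with rfl | hx
  · rw [abs_zero]; positivity
  · rw [negLogAbs_coe hx, EReal.coe_lt_coe_iff] at h
    rw [← Real.log_lt_iff_lt_exp (abs_pos.2 hx)]; linarith

theorem tendsto_zero_of_negLogAbs_bot {Δ : Type*} {F : Filter Δ} {η : Δ → CouplingConst}
    (h : Tendsto (fun δ => (η δ).negLogAbs) F (𝓝 ⊥)) {u v : Δ → ℂ} {B : ℝ}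
    (hB : ∀ᶠ δ in F, ‖v δ‖ ≤ B) (htop : ∀ᶠ δ in F, η δ = ⊤ → u δ = 0)
    (hfin : ∀ᶠ δ in F, ∀ x : ℝ, η δ = (x : WithTop ℝ) → v δ = x * u δ) :
    Tendsto u F (𝓝 0) := by
  rw [Metric.tendsto_nhds]
  intro ε hε
  set M := Real.log ((|B| + 1) / ε) with hM
  have hexp : Real.exp M = (|B| + 1) / ε := Real.exp_log (by positivity)
  filter_upwards [hB, htop, hfin, h.eventually_lt_const (EReal.bot_lt_coe (-M))] with δ h1 h2 h3 h4
  rw [dist_zero_right]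
  rcases eq_top_or_coe (η δ) with hη | ⟨x, hη⟩
  · rw [h2 hη, norm_zero]; exact hε
  · rw [hη] at h4
    have h5 := exp_lt_abs_of_negLogAbs_lt h4
    rw [h3 x hη, norm_mul, Complex.norm_real, Real.norm_eq_abs] at h1
    rw [hexp, div_lt_iff₀ hε] at h5
    by_contra! h6
    have h7 : |x| * ε ≤ |x| * ‖u δ‖ := mul_le_mul_of_nonneg_left h6 (abs_nonneg x)
    linarith [le_abs_self B]

theorem tendsto_zero_of_negLogAbs_top {Δ : Type*} {F : Filter Δ} {η : Δ → CouplingConst}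
    (h : Tendsto (fun δ => (η δ).negLogAbs) F (𝓝 ⊤)) {u v : Δ → ℂ} {B : ℝ}
    (hB : ∀ᶠ δ in F, ‖u δ‖ ≤ B)
    (hfin : ∀ᶠ δ in F, ∀ x : ℝ, η δ = (x : WithTop ℝ) → v δ = x * u δ) :
    Tendsto v F (𝓝 0) := by
  rw [Metric.tendsto_nhds]
  intro ε hε
  set M := Real.log ((|B| + 1) / ε) with hM
  have hexp : Real.exp (-M) = ε / (|B| + 1) := by
    rw [Real.exp_neg, Real.exp_log (by positivity), inv_div]
  filter_upwards [hB, hfin, h.eventually_const_lt (EReal.coe_lt_top M)] with δ h1 h3 h4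
  rw [dist_zero_right]
  rcases eq_top_or_coe (η δ) with hη | ⟨x, hη⟩
  · rw [hη, negLogAbs_top] at h4; exact absurd h4 (not_lt.2 bot_le)
  · rw [hη] at h4
    have h5 := abs_lt_exp_of_lt_negLogAbs h4
    rw [hexp, lt_div_iff₀ (by positivity)] at h5
    rw [h3 x hη, norm_mul, Complex.norm_real, Real.norm_eq_abs]
    have h6 : |x| * ‖u δ‖ ≤ |x| * |B| :=
      mul_le_mul_of_nonneg_left (h1.trans (le_abs_self B)) (abs_nonneg x)
    nlinarith [abs_nonneg x]

/-- The elementary relation between the conjugated coupling constant and the residue. -/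
theorem minRecip_mulReal_eq {η : CouplingConst} {u v : ℂ} {a b γ : ℝ} (ha : a ≠ 0) (hb : b ≠ 0)
    (hγ : 0 ≤ γ) (htop : η = ⊤ → u = 0) (hfin : ∀ x : ℝ, η = (x : WithTop ℝ) → v = x * u)
    (huv : u * v = γ * (a * b)) (hu : 0 < ((u / a) ^ 2).re) :
    (mulReal η (a * b⁻¹)).minRecip = min (γ / ((u / a) ^ 2).re) (max (γ / ((u / a) ^ 2).re) 1)⁻¹ := by
  have haC : (a : ℂ) ≠ 0 := by exact_mod_cast ha
  have hbC : (b : ℂ) ≠ 0 := by exact_mod_cast hb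
  rcases eq_top_or_coe η with hη | ⟨x, hη⟩
  · rw [htop hη] at hu; simp at hu
  · have hv := hfin x hη
    rw [hη, mulReal_coe]
    have h1 : ((x * (a * b⁻¹) : ℝ) : ℂ) * (u / a) ^ 2 = (γ : ℂ) := by
      rw [hv] at huv
      push_cast
      field_simp
      linear_combination huv
    have h2 : x * (a * b⁻¹) * ((u / a) ^ 2).re = γ := by
      have := congrArg Complex.re h1
      rwa [Complex.re_ofReal_mul, Complex.ofReal_re] at this
    have h3 : x * (a * b⁻¹) = γ / ((u / a) ^ 2).re := (eq_div_iff hu.ne').2 h2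
    rw [h3, minRecip_coe_of_nonneg (div_nonneg hγ hu.le)]

/-- The same relation read from the other factor: now the reciprocal of the conjugated constant is
`γ / ((v / b) ^ 2).re`. The value `∞` is possible and forces `γ = 0`. -/
theorem minRecip_mulReal_eq' {η : CouplingConst} {u v : ℂ} {a b γ : ℝ} (ha : a ≠ 0) (hb : b ≠ 0)
    (hγ : 0 ≤ γ) (htop : η = ⊤ → u = 0) (hfin : ∀ x : ℝ, η = (x : WithTop ℝ) → v = x * u)
    (huv : u * v = γ * (a * b)) (hv : 0 < ((v / b) ^ 2).re) :
    (mulReal η (a * b⁻¹)).minRecip = min (γ / ((v / b) ^ 2).re) (max (γ / ((v / b) ^ 2).re) 1)⁻¹ := by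
  have haC : (a : ℂ) ≠ 0 := by exact_mod_cast ha
  have hbC : (b : ℂ) ≠ 0 := by exact_mod_cast hb
  have hv0 : v ≠ 0 := by rintro rfl; simp at hv
  rcases eq_top_or_coe η with hη | ⟨x, hη⟩
  · rw [htop hη, zero_mul] at huv
    have h1 : γ = 0 := by
      have := (mul_eq_zero.1 huv.symm).resolve_right (mul_ne_zero haC hbC)
      exact_mod_cast this
    rw [hη, mulReal_top, minRecip_top, h1]; norm_num
  · have hvx := hfin x hη
    have hx : x ≠ 0 := by rintro rfl; simp [hvx] at hv0
    have hxC : (x : ℂ) ≠ 0 := by exact_mod_cast hx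
    have h0 : x * (a * b⁻¹) ≠ 0 := by
      have := inv_ne_zero hb
      positivity
    have h1 : (((x * (a * b⁻¹))⁻¹ : ℝ) : ℂ) * (v / b) ^ 2 = (γ : ℂ) := by
      have hu : u = v / x := by rw [hvx]; field_simp
      rw [hu] at huv
      push_cast
      field_simp at huv ⊢
      linear_combination huv
    have h2 : (x * (a * b⁻¹))⁻¹ * ((v / b) ^ 2).re = γ := by
      have := congrArg Complex.re h1
      rwa [Complex.re_ofReal_mul, Complex.ofReal_re] at this
    have h3 : (x * (a * b⁻¹))⁻¹ = γ / ((v / b) ^ 2).re := (eq_div_iff hv.ne').2 h2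
    rw [hη, mulReal_coe, minRecip_coe_inv h0, h3, minRecip_coe_of_nonneg (div_nonneg hγ hv.le)]

end CouplingConst

end CouplingConstants

/-! ### A bound common to all solutions. -/

section Solutions

open Metric Complex

variable {σ : Set ℝ} {η : σ → CouplingConst} {Φm Φp : ℂ → ℂ}

theorem IsCouplingSolution.isPositiveNumerator (h : IsCouplingSolution σ η Φm Φp) :
    IsPositiveNumerator σ fun z => Φm z * Φp z where
  differentiable := h.entire_m.1.mul h.entire_p.1
  hasZeroMeanType := h.entire_m.hasZeroMeanType.mul h.entire_p.hasZeroMeanType h.entire_m.1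
    h.entire_p.1
  map_zero := by simp [h.norm_m, h.norm_p]
  im_nonneg z hz := by simpa only [mul_assoc] using h.growth z hz

/-- The common majorant of all solutions. -/
noncomputable def couplingMajorant (σ : Set ℝ) (r : ℝ) : ℝ :=
  4 * Real.exp (∑' s : σ, Real.log (1 + max r 0 / |(s : ℝ)|))

theorem monotone_couplingMajorant (h0 : (0 : ℝ) ∉ σ) (hS : Summable fun s : σ => 1 / |(s : ℝ)|) :
    Monotone (couplingMajorant σ) := by
  intro r t hrt
  have hb := abs_pos_of_zero_notMem h0
  refine mul_le_mul_of_nonneg_left (Real.exp_le_exp.2 ?_) (by norm_num)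
  refine Summable.tsum_le_tsum (fun s => ?_)
    (summable_log_one_add_div hb hS (le_max_right r 0))
    (summable_log_one_add_div hb hS (le_max_right t 0))
  have h1 : 0 ≤ max r 0 / |(s : ℝ)| := by positivity
  have h2 : max r 0 / |(s : ℝ)| ≤ max t 0 / |(s : ℝ)| :=
    div_le_div_of_nonneg_right (max_le_max_right 0 hrt) (hb s).le
  exact Real.log_le_log (by linarith) (by linarith)

/-- Jensen for `g` shows that the average of `log |f|` is at most that of `log |f g|`, so the zeros
of `f` are no denser than `σ` up to `log 2`. The constant `4` in the majorant is `2 * exp (log 2)`.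
-/
theorem IsPositiveNumerator.norm_le_of_mul {f g : ℂ → ℂ} (h0 : (0 : ℝ) ∉ σ)
    (hS : Summable fun s : σ => 1 / |(s : ℝ)|) (hP : IsPositiveNumerator σ fun z => f z * g z)
    (hf : Differentiable ℂ f) (hg : Differentiable ℂ g) (hfT : HasZeroMeanType f) (hf0 : f 0 = 1)
    (hg0 : g 0 = 1) (w : ℂ) : ‖f w‖ ≤ couplingMajorant σ ‖w‖ := by
  have hb := abs_pos_of_zero_notMem h0
  have : Countable σ := countable_of_summable_one_div_abs h0 hS
  have h1 : ‖f w‖ ≤ 2 * Real.exp (Real.log 2 + ∑' s : σ, Real.log (1 + ‖w‖ / |(s : ℝ)|)) := by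
    refine hfT.norm_le_of_sum_log_le hf hf0 fun M k hM hk hk0 hfk => ?_
    rcases eq_or_ne w 0 with rfl | hw
    · simp [Real.log_nonneg one_le_two]
    refine sum_log_one_add_div_le hb hS hM (Real.log_nonneg one_le_two) (fun s hs => ?_)
      (norm_pos_iff.2 hw)
    have h2 := sum_posLog_le_circleAverage hM hk hk0 hfk hs
    have h3 := hP.circleAverage_log_norm_le h0 hS hs
    rw [circleAverage_log_norm_mul hf hg (x := 0) (y := 0) (by simp [hf0]) (by simp [hg0])
      hs.ne'] at h3
    linarith [circleAverage_log_norm_nonneg hg hg0 hs]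
  rw [Real.exp_add, Real.exp_log two_pos] at h1
  rw [couplingMajorant, max_eq_left (norm_nonneg w)]
  linarith

theorem IsCouplingSolution.norm_m_le (h0 : (0 : ℝ) ∉ σ)
    (hS : Summable fun s : σ => 1 / |(s : ℝ)|) (h : IsCouplingSolution σ η Φm Φp) (w : ℂ) :
    ‖Φm w‖ ≤ couplingMajorant σ ‖w‖ :=
  h.isPositiveNumerator.norm_le_of_mul h0 hS h.entire_m.1 h.entire_p.1
    h.entire_m.hasZeroMeanType h.norm_m h.norm_p w

theorem IsCouplingSolution.norm_p_le (h0 : (0 : ℝ) ∉ σ)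
    (hS : Summable fun s : σ => 1 / |(s : ℝ)|) (h : IsCouplingSolution σ η Φm Φp) (w : ℂ) :
    ‖Φp w‖ ≤ couplingMajorant σ ‖w‖ := by
  have h1 := h.isPositiveNumerator
  simp only [mul_comm (Φm _)] at h1
  exact h1.norm_le_of_mul h0 hS h.entire_p.1 h.entire_m.1
    h.entire_p.hasZeroMeanType h.norm_p h.norm_m w

end Solutions

/-! ### Identification of ultrafilter limits. -/

section UltrafilterLimit

open Metric Complex

theorem couplingW_image_ofReal {σ : Set ℝ} (A : Set σ)
    (hS : Summable fun s : (Subtype.val '' A : Set ℝ) => 1 / |(s : ℝ)|) (x : ℝ) :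
    couplingW (Subtype.val '' A) (x : ℂ) = ((∏' s : A, (1 - x / ((s : σ) : ℝ)) : ℝ) : ℂ) := by
  rw [couplingW_ofReal hS]
  congr 1
  exact tprod_image (fun s : ℝ => 1 - x / s) Subtype.val_injective.injOn

theorem conjugatedConst_eq {σ : Set ℝ} (h0 : (0 : ℝ) ∉ σ) (hσ : Summable fun s : σ => 1 / |(s : ℝ)|)
    (l₀ : σ) (A B : Set σ) (hB : l₀ ∉ B) (η : CouplingConst) :
    conjugatedConst l₀ A B η = η.mulReal ((∏' s : A, (1 - (l₀ : ℝ) / ((s : σ) : ℝ))) *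
      (∏' s : B, (1 - (l₀ : ℝ) / ((s : σ) : ℝ)))⁻¹) := by
  rw [conjugatedConst]
  congr 2
  have hS : Summable fun s : B => ‖-((l₀ : ℝ) / ((s : σ) : ℝ))‖ := by
    refine ((hσ.comp_injective (i := ((↑) : B → σ)) Subtype.val_injective).mul_left
      |(l₀ : ℝ)|).congr fun s => ?_
    rw [norm_neg, norm_div, Real.norm_eq_abs, Real.norm_eq_abs, Function.comp_apply, mul_one_div]
  refine Multipliable.tprod_inv₀ ?_ ?_
  · simpa [sub_eq_add_neg] using multipliable_one_add_of_summable hS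
  · have h1 := tprod_one_add_ne_zero_of_summable (fun s => ?_) hS
    · simpa only [← sub_eq_add_neg] using h1
    · rw [← sub_eq_add_neg, sub_ne_zero]
      intro h
      have hs0 : ((s : σ) : ℝ) ≠ 0 := fun h => h0 (h ▸ (s : σ).2)
      rw [eq_comm, div_eq_one_iff_eq hs0] at h
      exact hB (Subtype.ext h ▸ s.2)

/-- At `z = i t` the imaginary part has the sign of `1 - (γ - 1) (t / l)²`, which is negative for
large `t` if `γ > 1`. The chosen `t` makes the subtracted term `(γ - 1) + 2 + 1 / (γ - 1)`. -/
theorem le_one_of_im_nonneg {l γ : ℝ} (hl : l ≠ 0)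
    (h : ∀ z : ℂ, 0 < z.im → 0 ≤ (z * ((1 - (1 - γ) * z / l) / (1 - z / l))).im) : γ ≤ 1 := by
  by_contra! hγ
  set t := |l| * (1 + 1 / (γ - 1)) with ht
  have hγ1 : 0 < γ - 1 := by linarith
  have ht0 : 0 < t := by have := abs_pos.2 hl; positivity
  have hlC : (l : ℂ) ≠ 0 := by exact_mod_cast hl
  have h1 := h (t * I) (by simpa using ht0)
  have hden : (1 : ℂ) - t * I / l ≠ 0 := by
    intro h2
    have := congrArg Complex.re h2
    simp [Complex.div_ofReal_re] at this
  have hn : 0 < normSq ((1 : ℂ) - t * I / l) := normSq_pos.2 hden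
  have h3 : (t * I : ℂ) * ((1 - (1 - γ) * (t * I) / l) / (1 - t * I / l)) =
      (((t / normSq ((1 : ℂ) - t * I / l)) : ℝ) : ℂ) *
        (I * ((1 - (1 - γ) * (t * I) / l) * (1 + t * I / l))) := by
    have h4 : ((normSq ((1 : ℂ) - t * I / l) : ℝ) : ℂ) = (1 - t * I / l) * (1 + t * I / l) := by
      rw [← Complex.mul_conj]
      congr 1
      simp [neg_div]
    push_cast
    rw [h4]
    have hden2 : (1 : ℂ) + t * I / l ≠ 0 := by
      intro h2
      rw [h2, mul_zero] at h4
      exact hn.ne' (by exact_mod_cast h4)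
    have key : ∀ n x y : ℂ, x ≠ 0 → y ≠ 0 → (t * I : ℂ) * (n / x) = t / (x * y) * (I * (n * y)) := by
      intro n x y hx hy
      field_simp
    exact key _ _ _ hden hden2
  rw [h3, Complex.im_ofReal_mul, Complex.I_mul_im] at h1
  have h5 : ((1 - (1 - γ) * (t * I) / l) * (1 + t * I / l) : ℂ).re =
      1 - (γ - 1) * (t / l) ^ 2 := by
    have h6 : ((1 - (1 - γ) * (t * I) / l) * (1 + t * I / l) : ℂ) =
        ((1 - (γ - 1) * (t / l) ^ 2 : ℝ) : ℂ) + ((γ * (t / l) : ℝ) : ℂ) * I := by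
      push_cast
      linear_combination (-(1 - (γ : ℂ)) * (t / l) ^ 2) * Complex.I_sq
    rw [h6]
    simp [-Complex.ofReal_mul, -Complex.ofReal_sub, -Complex.ofReal_pow, -Complex.ofReal_div]
  rw [h5] at h1
  have h7 : 0 ≤ 1 - (γ - 1) * (t / l) ^ 2 :=
    nonneg_of_mul_nonneg_right h1 (by positivity)
  have h8 : (t / l) ^ 2 = (1 + 1 / (γ - 1)) ^ 2 := by
    rw [ht, div_pow, mul_pow, sq_abs]; field_simp
  have h9 : (γ - 1) * (1 + 1 / (γ - 1)) ^ 2 = (γ - 1) + 2 + 1 / (γ - 1) := by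
    field_simp; ring
  rw [h8, h9] at h7
  have : 0 < 1 / (γ - 1) := by positivity
  linarith

theorem tendsto_minRecip_of_tendsto {Δ : Type*} {F : Filter Δ} {g : Δ → ℝ} {q : Δ → ℂ} {γ : ℝ}
    (hγ1 : γ ≤ 1) (hg : Tendsto g F (𝓝 γ)) (hq : Tendsto q F (𝓝 1)) :
    (∀ᶠ δ in F, 0 < (q δ ^ 2).re) ∧
      Tendsto (fun δ => min (g δ / (q δ ^ 2).re) (max (g δ / (q δ ^ 2).re) 1)⁻¹) F (𝓝 γ) := by
  have h1 : Tendsto (fun δ => (q δ ^ 2).re) F (𝓝 1) := by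
    have := (Complex.continuous_re.tendsto _).comp (hq.pow 2)
    rw [one_pow, Complex.one_re] at this
    exact this
  refine ⟨h1.eventually_const_lt zero_lt_one, ?_⟩
  have h2 := hg.div h1 one_ne_zero
  rw [div_one] at h2
  have h3 := h2.min ((h2.max (tendsto_const_nhds (x := (1 : ℝ)))).inv₀ (by positivity))
  rwa [max_eq_right hγ1, inv_one, min_eq_left hγ1] at h3

/-- Limits of solutions of the coupling problem along an ultrafilter. -/
theorem exists_ultrafilter_limit {Δ : Type*} (U : Ultrafilter Δ) {D : Set Δ} (hD : D ∈ U)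
    {σ : Set ℝ} (hσ0 : (0 : ℝ) ∉ σ) (hσ : Summable fun s : σ => 1 / |(s : ℝ)|)
    {η : σ → Δ → CouplingConst} {l₀ : σ} {σm σp : Set σ}
    (hunion : σm ∪ {l₀} ∪ σp = Set.univ) (hmp : Disjoint σm σp) (hm : l₀ ∉ σm) (hp : l₀ ∉ σp)
    (hηm : ∀ s ∈ σm, Tendsto (fun δ => (η s δ).negLogAbs) U (𝓝 ⊥))
    (hηp : ∀ s ∈ σp, Tendsto (fun δ => (η s δ).negLogAbs) U (𝓝 ⊤))
    {Φm Φp : ℂ → Δ → ℂ}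
    (hsol : ∀ δ ∈ D,
      IsCouplingSolution σ (fun s => η s δ) (fun z => Φm z δ) (fun z => Φp z δ)) :
    ∃ (fm fp : ℂ → ℂ) (γ : ℝ), Continuous fm ∧ Continuous fp ∧
      TendstoLocallyUniformly (fun δ z => Φm z δ) fm (U : Filter Δ) ∧
      TendstoLocallyUniformly (fun δ z => Φp z δ) fp (U : Filter Δ) ∧
      (∀ z, couplingW σ z ≠ 0 → fm z * fp z / couplingW σ z = 1 + z / (((l₀ : ℝ) : ℂ) - z) * γ) ∧
      Tendsto (fun δ => (conjugatedConst l₀ σm σp (η l₀ δ)).minRecip) U (𝓝 γ) := by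
  have hB := monotone_couplingMajorant hσ0 hσ
  obtain ⟨fm, hfm, hfm1, hfm2⟩ := exists_tendstoLocallyUniformly_ultrafilter U hD hB
    (fun δ hδ => (hsol δ hδ).entire_m.1) fun δ hδ => (hsol δ hδ).norm_m_le hσ0 hσ
  obtain ⟨fp, hfp, hfp1, hfp2⟩ := exists_tendstoLocallyUniformly_ultrafilter U hD hB
    (fun δ hδ => (hsol δ hδ).entire_p.1) fun δ hδ => (hsol δ hδ).norm_p_le hσ0 hσ
  have hboundm : ∀ z, ∀ᶠ δ in (U : Filter Δ), ‖Φm z δ‖ ≤ couplingMajorant σ ‖z‖ := fun z => by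
    filter_upwards [hD] with δ hδ using (hsol δ hδ).norm_m_le hσ0 hσ z
  have hboundp : ∀ z, ∀ᶠ δ in (U : Filter Δ), ‖Φp z δ‖ ≤ couplingMajorant σ ‖z‖ := fun z => by
    filter_upwards [hD] with δ hδ using (hsol δ hδ).norm_p_le hσ0 hσ z
  have hfin : ∀ s : σ, ∀ᶠ δ in (U : Filter Δ), ∀ x : ℝ, η s δ = (x : WithTop ℝ) →
      Φp ((s : ℝ) : ℂ) δ = x * Φm ((s : ℝ) : ℂ) δ := fun s => by
    filter_upwards [hD] with δ hδ using (hsol δ hδ).coupling s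
  have htop : ∀ s : σ, ∀ᶠ δ in (U : Filter Δ), η s δ = ⊤ → Φm ((s : ℝ) : ℂ) δ = 0 := fun s => by
    filter_upwards [hD] with δ hδ using (hsol δ hδ).coupling_top s
  set l : ℝ := (l₀ : ℝ) with hl
  have hl0 : l ≠ 0 := fun h => hσ0 (h ▸ l₀.2)
  have hlC : (l : ℂ) ≠ 0 := by exact_mod_cast hl0
  set A : Set ℝ := Subtype.val '' σm with hA
  set B : Set ℝ := Subtype.val '' σp with hBdef
  have hAσ : A ⊆ σ := by rintro _ ⟨s, -, rfl⟩; exact s.2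
  have hBσ : B ⊆ σ := by rintro _ ⟨s, -, rfl⟩; exact s.2
  have hA0 : (0 : ℝ) ∉ A := fun h => hσ0 (hAσ h)
  have hB0 : (0 : ℝ) ∉ B := fun h => hσ0 (hBσ h)
  have hsA := hσ.one_div_abs_mono hAσ
  have hsB := hσ.one_div_abs_mono hBσ
  have hlA : l ∉ A := by rintro ⟨s, hs, h⟩; exact hm (Subtype.ext h ▸ hs)
  have hlB : l ∉ B := by rintro ⟨s, hs, h⟩; exact hp (Subtype.ext h ▸ hs)
  have hAB : Disjoint A B := (Set.disjoint_image_iff Subtype.val_injective).2 hmp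
  have hdiff : σ \ {l} = A ∪ B := by
    ext s
    constructor
    · rintro ⟨hs, hsl⟩
      have h1 : (⟨s, hs⟩ : σ) ∈ σm ∪ {l₀} ∪ σp := by rw [hunion]; trivial
      rcases h1 with (h1 | h1) | h1
      · exact Or.inl ⟨_, h1, rfl⟩
      · exact absurd (congrArg Subtype.val h1) hsl
      · exact Or.inr ⟨_, h1, rfl⟩
    · rintro (h | h)
      · exact ⟨hAσ h, fun h1 => hlA (h1 ▸ h)⟩
      · exact ⟨hBσ h, fun h1 => hlB (h1 ▸ h)⟩
  have hW1 : ∀ z, couplingW (σ \ {l}) z = couplingW A z * couplingW B z := fun z => by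
    rw [hdiff]; exact couplingW_union hAB hsA hsB z
  have hW : ∀ z, couplingW σ z = couplingW A z * couplingW B z * (1 - z / l) := fun z => by
    have h1 := hσ.one_div_abs_mono (Set.sdiff_subset (s := σ) (t := {l}))
    have h2 := hσ.one_div_abs_mono (Set.singleton_subset_iff.2 l₀.2)
    rw [← hW1, ← couplingW_singleton, ← couplingW_union Set.disjoint_sdiff_left h1 h2,
      Set.sdiff_union_of_subset (Set.singleton_subset_iff.2 l₀.2)]
  have hfm0 : ∀ s ∈ A, fm ((s : ℝ) : ℂ) = 0 := by
    rintro _ ⟨s, hs, rfl⟩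
    exact tendsto_nhds_unique (hfm1 _) (CouplingConst.tendsto_zero_of_negLogAbs_bot (hηm s hs)
      (hboundp _) (htop s) (hfin s))
  have hfp0 : ∀ s ∈ B, fp ((s : ℝ) : ℂ) = 0 := by
    rintro _ ⟨s, hs, rfl⟩
    exact tendsto_nhds_unique (hfp1 _) (CouplingConst.tendsto_zero_of_negLogAbs_top (hηp s hs)
      (hboundm _) (hfin s))
  have hfmone : fm 0 = 1 := tendsto_nhds_unique (hfm1 0) (tendsto_const_nhds.congr' (by
    filter_upwards [hD] with δ hδ using (hsol δ hδ).norm_m.symm))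
  have hfpone : fp 0 = 1 := tendsto_nhds_unique (hfp1 0) (tendsto_const_nhds.congr' (by
    filter_upwards [hD] with δ hδ using (hsol δ hδ).norm_p.symm))
  have htype : ∀ {f : ℂ → ℂ} {Φ : ℂ → Δ → ℂ}, Differentiable ℂ f →
      (∀ z, Tendsto (Φ z) U (𝓝 (f z))) →
      (∀ z, ∀ᶠ δ in (U : Filter Δ), ‖Φ z δ‖ ≤ couplingMajorant σ ‖z‖) → HasZeroMeanType f := by
    intro f Φ hf h1 h2
    refine (isEntireTypeZero_of_norm_le hσ0 hσ hf (c := 4) (by norm_num)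
      fun z => ?_).hasZeroMeanType
    have h3 := le_of_tendsto (h1 z).norm (h2 z)
    rwa [couplingMajorant, max_eq_left (norm_nonneg z)] at h3
  have hfmT := htype hfm hfm1 hboundm
  have hfpT := htype hfp hfp1 hboundp
  obtain ⟨gm, hgm, hgm1⟩ := exists_eq_couplingW_mul hA0 hsA hfm hfm0
  obtain ⟨gp, hgp, hgp1⟩ := exists_eq_couplingW_mul hB0 hsB hfp hfp0
  have hgmT := hfmT.cofactor (isEntireTypeZero_couplingW hA0 hsA).hasZeroMeanType hfm
    (differentiable_couplingW hsA) hgm couplingW_zero hgm1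
  have hgpT := hfpT.cofactor (isEntireTypeZero_couplingW hB0 hsB).hasZeroMeanType hfp
    (differentiable_couplingW hsB) hgp couplingW_zero hgp1
  have hgm0 : gm 0 = 1 := by have := hgm1 0; rwa [hfmone, couplingW_zero, one_mul, eq_comm] at this
  have hgp0 : gp 0 = 1 := by have := hgp1 0; rwa [hfpone, couplingW_zero, one_mul, eq_comm] at this
  have hprod : ∀ z, Tendsto (fun δ => Φm z δ * Φp z δ) U (𝓝 (fm z * fp z)) := fun z =>
    (hfm1 z).mul (hfp1 z)
  have hlin : ∃ c : ℂ, ∀ z, gm z * gp z = gm 0 * gp 0 + c * z := by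
    -- Julia's inequality survives the limit. Cancelling the products over `A` and `B` leaves the
    -- bound `‖1 - z / l‖ ‖z‖`, which is quadratic in `‖z‖`.
    refine exists_eq_add_mul_of_norm_mul_abs_im_le (hgm.mul hgp) (A := 1 + 1 / |l|) fun z => ?_
    rcases eq_or_ne z.im 0 with hz | hz
    · rw [hz, abs_zero, mul_zero]; positivity
    have h1 : ‖fm z * fp z‖ * |z.im| ≤ ‖couplingW σ z‖ * ‖z‖ := by
      refine le_of_tendsto ((hprod z).norm.mul_const _) ?_
      filter_upwards [hD] with δ hδ
      exact (hsol δ hδ).isPositiveNumerator.norm_mul_abs_im_le hσ0 hσ z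
    have hAz : 0 < ‖couplingW A z‖ := norm_pos_iff.2 (couplingW_ne_zero_of_im hA0 hsA hz)
    have hBz : 0 < ‖couplingW B z‖ := norm_pos_iff.2 (couplingW_ne_zero_of_im hB0 hsB hz)
    rw [hgm1, hgp1, hW] at h1
    simp only [norm_mul] at h1
    have h2 : ‖gm z * gp z‖ * |z.im| ≤ ‖1 - z / l‖ * ‖z‖ := by
      refine le_of_mul_le_mul_left ?_ (mul_pos hAz hBz)
      rw [norm_mul]
      linarith
    refine h2.trans ?_
    have h3 : ‖1 - z / l‖ ≤ 1 + ‖z‖ / |l| := by simpa using norm_sub_le (1 : ℂ) (z / l)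
    have h4 : 0 ≤ 1 / |l| := by positivity
    have h5 : ‖z‖ / |l| = 1 / |l| * ‖z‖ := by ring
    rw [h5] at h3
    calc ‖1 - z / l‖ * ‖z‖ ≤ (1 + 1 / |l| * ‖z‖) * ‖z‖ :=
          mul_le_mul_of_nonneg_right h3 (norm_nonneg z)
      _ ≤ (1 + 1 / |l|) * (1 + ‖z‖) ^ 2 := by
          nlinarith [norm_nonneg z, mul_nonneg h4 (norm_nonneg z)]
  obtain ⟨c, hc⟩ := hlin
  rw [hgm0, hgp0, one_mul] at hc
  set a : ℝ := ∏' s : σm, (1 - l / ((s : σ) : ℝ)) with ha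
  set b : ℝ := ∏' s : σp, (1 - l / ((s : σ) : ℝ)) with hb
  have hAl : couplingW A (l : ℂ) = (a : ℂ) := couplingW_image_ofReal σm hsA l
  have hBl : couplingW B (l : ℂ) = (b : ℂ) := couplingW_image_ofReal σp hsB l
  have ha0 : a ≠ 0 := by
    have := couplingW_ne_zero hA0 hsA (z := (l : ℂ)) fun s hs h =>
      hlA (Complex.ofReal_injective h ▸ hs)
    rw [hAl] at this; exact_mod_cast this
  have hb0 : b ≠ 0 := by
    have := couplingW_ne_zero hB0 hsB (z := (l : ℂ)) fun s hs h =>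
      hlB (Complex.ofReal_injective h ▸ hs)
    rw [hBl] at this; exact_mod_cast this
  have haC : (a : ℂ) ≠ 0 := by exact_mod_cast ha0
  have hbC : (b : ℂ) ≠ 0 := by exact_mod_cast hb0
  -- The residue condition makes this quotient real and nonnegative for `δ ∈ D`, so taking the real
  -- part loses nothing.
  set g : Δ → ℝ := fun δ => (Φm l δ * Φp l δ / (a * b)).re with hg
  have hgD : ∀ δ ∈ D, 0 ≤ g δ ∧ Φm l δ * Φp l δ = g δ * (a * b) := by
    intro δ hδ
    obtain ⟨γ, hγ, h1⟩ := (hsol δ hδ).isPositiveNumerator.residue_nonneg hσ0 hσ l₀.2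
    rw [hW1, hAl, hBl] at h1
    have h2 : g δ = γ := by
      have h3 : Φm l δ * Φp l δ / (a * b) = (γ : ℂ) := by
        rw [div_eq_iff (mul_ne_zero haC hbC)]; exact h1
      simp only [hg, h3, Complex.ofReal_re]
    rw [h2]; exact ⟨hγ, h1⟩
  have hlimC : Tendsto (fun δ => Φm l δ * Φp l δ / (a * b)) U (𝓝 (gm l * gp l)) := by
    have h1 := (hprod l).div_const ((a : ℂ) * b)
    rw [hgm1, hgp1, hAl, hBl, mul_mul_mul_comm, mul_div_cancel_left₀ _ (mul_ne_zero haC hbC)] at h1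
    exact h1
  set γ : ℝ := (gm l * gp l).re with hγ
  have hglim : Tendsto g U (𝓝 γ) := (Complex.continuous_re.tendsto _).comp hlimC
  have hγC : gm l * gp l = (γ : ℂ) := by
    refine tendsto_nhds_unique hlimC ?_
    refine ((Complex.continuous_ofReal.tendsto γ).comp hglim).congr' ?_
    filter_upwards [hD] with δ hδ
    rw [Function.comp_apply, eq_div_iff (mul_ne_zero haC hbC), (hgD δ hδ).2]
  have hγ0 : 0 ≤ γ := ge_of_tendsto hglim (by filter_upwards [hD] with δ hδ using (hgD δ hδ).1)
  have hcl : c = (γ - 1) / l := by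
    have := hc l
    rw [hγC] at this
    rw [eq_div_iff hlC]; linear_combination -this
  have hquot : ∀ z, couplingW A z * couplingW B z ≠ 0 →
      fm z * fp z / couplingW σ z = (1 - (1 - γ) * z / l) / (1 - z / l) := by
    intro z hz
    rw [hgm1, hgp1, hW, mul_mul_mul_comm, mul_div_mul_left _ _ hz, hc, hcl]
    congr 1
    ring
  have hγ1 : γ ≤ 1 := by
    refine le_one_of_im_nonneg hl0 fun z hz => ?_
    rw [← hquot z (mul_ne_zero (couplingW_ne_zero_of_im hA0 hsA hz.ne')
      (couplingW_ne_zero_of_im hB0 hsB hz.ne')), ← mul_div_assoc]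
    refine ge_of_tendsto ((Complex.continuous_im.tendsto _).comp
      (((hprod z).const_mul z).div_const (couplingW σ z))) ?_
    filter_upwards [hD] with δ hδ
    exact (hsol δ hδ).isPositiveNumerator.im_nonneg z hz
  refine ⟨fm, fp, γ, hfm.continuous, hfp.continuous, hfm2, hfp2, fun z hz => ?_, ?_⟩
  · rw [hW] at hz
    have h1 : (1 : ℂ) - z / l ≠ 0 := right_ne_zero_of_mul hz
    rw [hquot z (left_ne_zero_of_mul hz)]
    have h2 : (l : ℂ) - z ≠ 0 := by
      intro h; apply h1; rw [← sub_eq_zero.1 h, div_self hlC, sub_self]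
    have h3 : (1 : ℂ) - z / l = (l - z) / l := by field_simp
    rw [h3]
    field_simp
    ring
  · simp only [conjugatedConst_eq hσ0 hσ l₀ σm σp hp, ← hl, ← ha, ← hb]
    -- Whichever cofactor is trivial determines which normalized value at `l` tends to `1`, and so
    -- whether the conjugated constant or its reciprocal tends to `γ`.
    rcases eq_one_or_eq_one_of_mul_eq_linear hgm hgp hgmT hgpT hgm0 hgp0 hc with h1 | h1
    · have hq : Tendsto (fun δ => Φm l δ / a) U (𝓝 1) := by
        have := (hfm1 l).div_const (a : ℂ)
        rwa [hgm1, hAl, h1, mul_one, div_self haC] at this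
      obtain ⟨h2, h3⟩ := tendsto_minRecip_of_tendsto hγ1 hglim hq
      refine h3.congr' ?_
      filter_upwards [hD, h2, hfin l₀, htop l₀] with δ hδ h4 h5 h6
      exact (CouplingConst.minRecip_mulReal_eq ha0 hb0 (hgD δ hδ).1 h6 h5 (hgD δ hδ).2 h4).symm
    · have hq : Tendsto (fun δ => Φp l δ / b) U (𝓝 1) := by
        have := (hfp1 l).div_const (b : ℂ)
        rwa [hgp1, hBl, h1, mul_one, div_self hbC] at this
      obtain ⟨h2, h3⟩ := tendsto_minRecip_of_tendsto hγ1 hglim hq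
      refine h3.congr' ?_
      filter_upwards [hD, h2, hfin l₀, htop l₀] with δ hδ h4 h5 h6
      exact (CouplingConst.minRecip_mulReal_eq' ha0 hb0 (hgD δ hδ).1 h6 h5 (hgD δ hδ).2 h4).symm

end UltrafilterLimit

/-! ### From ultrafilters to the locally uniform limit. -/

theorem mainTheorem1
    {Δ : Type*} [TopologicalSpace Δ] [FirstCountableTopology Δ] (D : Set Δ) (δinf : Δ)
    (σ : Set ℝ) (hσ0 : (0 : ℝ) ∉ σ) (hσ : Summable fun s : σ => 1 / |(s : ℝ)|)
    (η : σ → Δ → CouplingConst)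
    (l₀ : σ) (σm σp : Set σ)
    (hunion : σm ∪ {l₀} ∪ σp = Set.univ)
    (hmp : Disjoint σm σp) (hm : l₀ ∉ σm) (hp : l₀ ∉ σp)
    (hηm : ∀ s ∈ σm, Tendsto (fun δ => (η s δ).negLogAbs) (𝓝[D] δinf) (𝓝 ⊥))
    (hηp : ∀ s ∈ σp, Tendsto (fun δ => (η s δ).negLogAbs) (𝓝[D] δinf) (𝓝 ⊤))
    (Φm Φp : ℂ → Δ → ℂ)
    (hsol : ∀ δ ∈ D,
      IsCouplingSolution σ (fun s => η s δ) (fun z => Φm z δ) (fun z => Φp z δ)) :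
    TendstoLocallyUniformlyOn
      (fun (δ : Δ) (z : ℂ) =>
        Φm z δ * Φp z δ / couplingW σ z -
          (1 + z / (((l₀ : ℝ) : ℂ) - z) *
            (((conjugatedConst l₀ σm σp (η l₀ δ)).minRecip : ℝ) : ℂ)))
      (fun _ => 0) (𝓝[D] δinf) (((fun x : ℝ => (x : ℂ)) '' σ)ᶜ) := by
  have hWd := differentiable_couplingW hσ
  have hset : ((fun x : ℝ => (x : ℂ)) '' σ)ᶜ = {z | couplingW σ z ≠ 0} := by
    ext z
    simp only [Set.mem_compl_iff, Set.mem_image, Set.mem_ofPred_eq, ne_eq,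
      couplingW_eq_zero_iff hσ0 hσ, eq_comm (a := z)]
  have hopen : IsOpen {z | couplingW σ z ≠ 0} := isOpen_ne.preimage hWd.continuous
  rw [hset, tendstoLocallyUniformlyOn_iff_forall_isCompact hopen]
  intro K hKs hK
  rw [Metric.tendstoUniformlyOn_iff]
  intro ε hε
  -- The limits and `γ` may depend on `U`. This is harmless: the coupling term tends to the same `γ`
  -- along `U`, so the difference tends to zero along every ultrafilter.
  refine Filter.mem_iff_ultrafilter.2 fun U hU => ?_
  have hD : D ∈ U := hU self_mem_nhdsWithin
  obtain ⟨fm, fp, γ, hfm, hfp, hm1, hp1, hquot, hγ⟩ := exists_ultrafilter_limit U hD hσ0 hσ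
    hunion hmp hm hp (fun s hs => (hηm s hs).mono_left hU) (fun s hs => (hηp s hs).mono_left hU)
    hsol
  have hne : ∀ z ∈ K, couplingW σ z ≠ 0 := fun z hz => hKs hz
  have hlne : ∀ z ∈ K, ((l₀ : ℝ) : ℂ) - z ≠ 0 := fun z hz h => hne z hz
    ((couplingW_eq_zero_iff hσ0 hσ).2 ⟨l₀, l₀.2, (sub_eq_zero.1 h).symm⟩)
  have hmul : TendstoUniformlyOn (fun δ z => Φm z δ * Φp z δ) (fun z => fm z * fp z) (U : Filter Δ)
      K := by
    rw [← tendstoLocallyUniformlyOn_iff_tendstoUniformlyOn_of_compact hK]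
    exact (hm1.tendstoLocallyUniformlyOn (s := K)).fun_mul₀ hp1.tendstoLocallyUniformlyOn
      hfm.continuousOn hfp.continuousOn
  obtain ⟨C₁, hC₁⟩ := hK.exists_bound_of_continuousOn (f := fun z => (couplingW σ z)⁻¹)
    (hWd.continuous.continuousOn.inv₀ hne)
  obtain ⟨C₂, hC₂⟩ := hK.exists_bound_of_continuousOn (f := fun z => z / (((l₀ : ℝ) : ℂ) - z))
    (continuousOn_id.div (by fun_prop) hlne)
  have hε1 : 0 < ε / 2 / (|C₁| + 1) := by positivity
  have hε2 : 0 < ε / 2 / (|C₂| + 1) := by positivity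
  filter_upwards [Metric.tendstoUniformlyOn_iff.1 hmul _ hε1, Metric.tendsto_nhds.1 hγ _ hε2]
    with δ h1 h2 z hz
  have h3 := h1 z hz
  rw [dist_comm, dist_eq_norm, lt_div_iff₀ (by positivity)] at h3
  rw [Real.dist_eq, lt_div_iff₀ (by positivity)] at h2
  set m : ℝ := (conjugatedConst l₀ σm σp (η l₀ δ)).minRecip with hmdef
  have h4 : Φm z δ * Φp z δ / couplingW σ z - (1 + z / (((l₀ : ℝ) : ℂ) - z) * (m : ℂ)) =
      (Φm z δ * Φp z δ - fm z * fp z) * (couplingW σ z)⁻¹ -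
        z / (((l₀ : ℝ) : ℂ) - z) * ((m - γ : ℝ) : ℂ) := by
    rw [sub_mul, ← div_eq_mul_inv, ← div_eq_mul_inv, hquot z (hne z hz)]
    push_cast
    ring
  rw [dist_zero_left, h4]
  refine (norm_sub_le _ _).trans_lt ?_
  rw [norm_mul, norm_mul, Complex.norm_real, Real.norm_eq_abs]
  have h5 : ‖Φm z δ * Φp z δ - fm z * fp z‖ * ‖(couplingW σ z)⁻¹‖ ≤
      ‖Φm z δ * Φp z δ - fm z * fp z‖ * (|C₁| + 1) :=
    mul_le_mul_of_nonneg_left (by linarith [hC₁ z hz, le_abs_self C₁]) (norm_nonneg _)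
  have h6 : ‖z / (((l₀ : ℝ) : ℂ) - z)‖ * |m - γ| ≤ (|C₂| + 1) * |m - γ| :=
    mul_le_mul_of_nonneg_right (by linarith [hC₂ z hz, le_abs_self C₂]) (abs_nonneg _)
  linarith
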